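/- Let $d\ge 1$ be an integer, $m_c=(1-\tfrac2d)_+$ and $m_c<m<1$. For $\alpha\in(0,1)$ put $b=b_{\alpha,m}=\frac{\alpha}{2+d(m-1)}$, $$Q(\eta)=\frac1{\Gamma(1-\alpha)}\int_\eta^1(1-\sigma^{1/b})^{-\alpha}\sigma^{1-d}\,d\sigma,\qquad K(z,\rho)=\rho\,Q(z/\rho),\qquad \mathsf Q(\gamma)=\int_0^1Q(\sigma)\sigma^{\gamma-3}\,d\sigma ,$$ and call $U\ge 0$ on $(0,\infty)$ a profile if $U(z)^m=\int_z^\infty K(z,\rho)U(\rho)\,d\rho$ (a convergent integral) for all $z>0$. Let $$U^*_{\alpha,m}(z)=c^*_{\alpha,m}z^{-\frac2{1-m}},\qquad c^*_{\alpha,m}=\Big(\frac{(1-m)b_{\alpha,m}}{2m}\,\frac{\Gamma(\frac{\alpha}{1-m})}{\Gamma(1-\alpha+\frac{\alpha}{1-m})}\Big)^{-\frac1{1-m}}$$ be the time-fractional very singular solution (the formulas for $b$ and $c^*$ are also used for $\alpha=1$), let $\gamma^*>0$ be defined by $\mathsf Q(\frac2{1-m}+\gamma^*)=m\,\mathsf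 Q(\frac2{1-m})$, and let the canonical profile be $$\mathcal U_{\alpha,m}=\lim_{n\to\infty}T^n\underline{\mathcal U},\qquad \underline{\mathcal U}(z)=U^*_{\alpha,m}(z)(1-z^{-\gamma^*})_+,\qquad (TU)(z)=\Big(\int_z^\infty K(z,\rho)U(\rho)\,d\rho\Big)^{1/m}.$$ For $M>0$ let $U_{\alpha,m,M}(z)=A\,\mathcal U_{\alpha,m}(Lz)$, where $A^{1+\frac{(m-1)d}2}=\dfrac{M}{|\partial B_1|\int_0^\infty\mathcal U_{\alpha,m}(\rho)\rho^{d-1}d\rho}$ and $L=A^{-\frac{m-1}2}$. Then, for every $\alpha\in(0,1)$, $\gamma^*$ exists and is unique, the limit defining $\mathcal U_{\alpha,m}$ exists at every $z>0$, $\mathcal U_{\alpha,m}$ is continuous on $(0,\infty)$ and is a profile with $z^{d-1}\mathcal U_{\alpha,m}\in L^1(0,\infty)$, and $U_{\alpha,m,M}$ is a profile with $z^{d-1}U_{\alpha,m,M}\in L^1(0,\infty)$ and $|\partial B_1|\int_0^\infty U_{\alpha,m,M}(\rho)\rho^{d-1}d\rho=M$. Moreover: 1. $\mathcal U_{\alpha,m}$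 and $U_{\alpha,m,M}$ are strictly positive and strictly decreasing on $(0,\infty)$. 2. There is a function $\mathcal R_{\alpha,m}$ with $\mathcal R_{\alpha,m}(z)=o(z^{-\gamma^*})$ as $z\to\infty$ such that for all $z>0$ and $M>0$ $$\mathcal U_{\alpha,m}(z)=U^*_{\alpha,m}(z)\big(1-z^{-\gamma^*}+\mathcal R_{\alpha,m}(z)\big),\qquad U_{\alpha,m,M}(z)=U^*_{\alpha,m}(z)\big(1-(Lz)^{-\gamma^*}+\mathcal R_{\alpha,m}(Lz)\big).$$ 3. If $0<M_1<M_2$, then $U_{\alpha,m,M_1}(z)<U_{\alpha,m,M_2}(z)$ for all $z>0$; and for each $z>0$, $U_{\alpha,m,M}(z)\nearrow U^*_{\alpha,m}(z)$ as $M\to\infty$ and $U_{\alpha,m,M}(z)\searrow0$ as $M\to0^+$. 4. For each $z>0$, $\displaystyle\lim_{\alpha\to1^-}\mathcal U_{\alpha,m}(z)=c^*_{1,m}\,(1-m+z^2)^{-\frac1{1-m}}$. -/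

import Mathlib

open Real Set Filter Topology MeasureTheory Asymptotics

namespace FastDiffusion

noncomputable section

/-- The critical exponent `m_c = (1 - 2/d)_+`. -/
def mCrit (d : ℕ) : ℝ := max (1 - 2 / (d : ℝ)) 0

/-- The similarity exponent `b = α / (2 + d (m - 1))`. -/
def bExp (d : ℕ) (α m : ℝ) : ℝ := α / (2 + d * (m - 1))

/-- `Q(η) = Γ(1-α)⁻¹ ∫_η^1 (1 - σ^{1/b})^{-α} σ^{1-d} dσ`. -/
def Q (d : ℕ) (α m η : ℝ) : ℝ :=
  1 / Gamma (1 - α) *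
    ∫ σ in η..1, (1 - σ ^ (1 / bExp d α m)) ^ (-α) * σ ^ (1 - (d : ℝ))

/-- The kernel `K(z,ρ) = ρ Q(z/ρ)`, used for `0 < z < ρ`. -/
def K (d : ℕ) (α m z ρ : ℝ) : ℝ := ρ * Q d α m (z / ρ)

/-- The operator `(T U)(z) = (∫_z^∞ K(z,ρ) U(ρ) dρ)^{1/m}`. -/
def fixOp (d : ℕ) (α m : ℝ) (U : ℝ → ℝ) (z : ℝ) : ℝ :=
  (∫ ρ in Ioi z, K d α m z ρ * U ρ) ^ (1 / m)

/-- `U` solves the profile equation `U(z)^m = ∫_z^∞ K(z,ρ) U(ρ) dρ` for all `z > 0`,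
the integral being convergent. -/
def SolvesProfileEq (d : ℕ) (α m : ℝ) (U : ℝ → ℝ) : Prop :=
  ∀ z, 0 < z → IntegrableOn (fun ρ => K d α m z ρ * U ρ) (Ioi z) ∧
    U z ^ m = ∫ ρ in Ioi z, K d α m z ρ * U ρ

/-- The constant `c*_{α,m}` of the very singular solution (meaningful also for `α = 1`). -/
def cStar (d : ℕ) (α m : ℝ) : ℝ :=
  ((1 - m) * bExp d α m / (2 * m) *
    (Gamma (α / (1 - m)) / Gamma (1 - α + α / (1 - m)))) ^ (-1 / (1 - m))

/-- The time-fractional very singular solution `U*(z) = c* z^{-2/(1-m)}`. -/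
def vss (d : ℕ) (α m z : ℝ) : ℝ := cStar d α m * z ^ (-2 / (1 - m))

/-- The Beta-type integral `∫_0^1 Q(σ) σ^{γ-3} dσ`. -/
def Qmoment (d : ℕ) (α m γ : ℝ) : ℝ := ∫ σ in (0 : ℝ)..1, Q d α m σ * σ ^ (γ - 3)

/-- The implicit equation for the tail exponent. -/
def TailExponentEq (d : ℕ) (α m γ : ℝ) : Prop :=
  Qmoment d α m (2 / (1 - m) + γ) = m * Qmoment d α m (2 / (1 - m))

/-- The tail exponent `γ*`: the positive solution of `TailExponentEq` (there is exactly one). -/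
def gammaStar (d : ℕ) (α m : ℝ) : ℝ := sInf {γ | 0 < γ ∧ TailExponentEq d α m γ}

/-- The subsolution `U*(z) (1 - z^{-γ*})_+` from which the canonical profile is iterated. -/
def subsol (d : ℕ) (α m z : ℝ) : ℝ :=
  vss d α m z * max (1 - z ^ (-gammaStar d α m)) 0

/-- The canonical profile: the pointwise limit of the iterates of `fixOp` on `subsol`. -/
def canonicalProfile (d : ℕ) (α m z : ℝ) : ℝ :=
  limUnder atTop (fun n : ℕ => ((fixOp d α m)^[n] (subsol d α m)) z)

/-- The surface area `|∂B_1|` of the unit sphere of `ℝ^d`. -/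
def sphereArea (d : ℕ) : ℝ :=
  (volume : Measure (EuclideanSpace ℝ (Fin d))).toSphere.real univ

/-- The mass `|∂B_1| ∫_0^∞ U(ρ) ρ^{d-1} dρ` of a radial profile. -/
def mass (d : ℕ) (U : ℝ → ℝ) : ℝ :=
  sphereArea d * ∫ ρ in Ioi (0 : ℝ), U ρ * ρ ^ ((d : ℝ) - 1)

/-- The amplitude `A`, with `A^{1 + (m-1)d/2} = M / mass(canonicalProfile)`. -/
def amp (d : ℕ) (α m M : ℝ) : ℝ :=
  (M / mass d (canonicalProfile d α m)) ^ (1 / (1 + (m - 1) * d / 2))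

/-- The length factor `L = A^{-(m-1)/2}`. -/
def lenFactor (d : ℕ) (α m M : ℝ) : ℝ := amp d α m M ^ (-(m - 1) / 2)

/-- The profile of mass `M`: `z ↦ A 𝒰(L z)`, with `𝒰` the canonical profile. -/
def profile (d : ℕ) (α m M z : ℝ) : ℝ :=
  amp d α m M * canonicalProfile d α m (lenFactor d α m M * z)

end

end FastDiffusion

open FastDiffusion

/-!
Divided by the very singular solution `vss`, the operator `fixOp` becomes
`ratioStep : f ↦ (∫_0^1 k(σ) f(z/σ) dσ)^{1/m}`, where `k` (`ratioKernel`) is the *probability*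
density on `(0, 1)` proportional to `Q(σ) σ^{2/(1-m)-3}`; that `vss` is a fixed point of `fixOp` is the
evaluation of `∫ Q(σ) σ^{2/(1-m)-3} dσ` by a Beta integral. The equation for `γ*` says that the moment
of order `γ*` of `k` equals `m`. Moments decrease strictly and continuously from `1` to `0`, so `γ*`
exists and is unique.

On functions with values in `[0, 1]` the power `1/m` is `1/m`-Lipschitz, and averaging against `k`
multiplies the weight `z^{-2γ*}` by the moment of order `2γ*`, which is less than `m`. So `ratioStep`
is a contraction for the norm `sup z^{2γ*} |f(z)|` (`abs_ratioStep_sub_le`). The starting function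
`(1 - z^{-γ*})_+` is moved by at most `1` in this norm, by two Bernoulli inequalities
(`abs_ratioStep_startRatio_sub_le`). Hence its iterates converge geometrically to a fixed point
`V = limitRatio`, which is continuous, nondecreasing, and satisfies `V = 1 - z^{-γ*} + O(z^{-2γ*})`:
this is the tail expansion. The canonical profile is `vss * V`, the profile of mass `M` is
`vss(z) V(L z)`, and the ordering in `M` is the strict monotonicity of `V`
(`limitRatio_strictMonoOn`). Strict decrease of a profile is read off from the profile equation
itself, as `K` is nonincreasing in its first argument.

At zero, `V` has a limit `l < 1` with `l^m = l`, so `l = 0`. Feeding smallness near zero back into the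
iteration gives `V ≤ C z^a` for every positive `a < 2/(1-m) - max(2, d)`, and one more averaging gives the
power `a/m`, which is enough for finite mass (`exists_limitRatio_le_rpow`,
`integrableOn_canonicalProfile_mul`).

As `α → 1`, `Q` tends pointwise to the constant `b_{1,m}`, so the densities tend to
`(p-2) σ^{p-3}`, `p = 2/(1-m)`. Being probability densities they then converge in `L¹` (Scheffé), so
every single iterate converges, and since the contraction factors stay away from one the fixed points
converge too (`tendsto_limitRatio`). For the limiting density the fixed point is explicit, namely the
Barenblatt profile divided by the very singular solution (`limitRatio_classicalKernel`), by uniqueness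
of the fixed point with the given tail (`eq_limitRatio`).
-/

namespace FastDiffusion

/-! ### Densities on `(0, 1)` and the averaging operator -/

/-- A probability density on `(0, 1)` that is positive everywhere. -/
structure IsDensity (k : ℝ → ℝ) : Prop where
  pos : ∀ σ ∈ Ioo (0 : ℝ) 1, 0 < k σ
  integrable : IntegrableOn k (Ioo 0 1)
  integral_eq : ∫ σ in Ioo (0 : ℝ) 1, k σ = 1

/-- The multiplicative average `∫_0^1 k(σ) f(z/σ) dσ`. -/
noncomputable def avg (k f : ℝ → ℝ) (z : ℝ) : ℝ := ∫ σ in Ioo (0 : ℝ) 1, k σ * f (z / σ)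

/-- The moment `∫_0^1 k(σ) σ^γ dσ`. -/
noncomputable def moment (k : ℝ → ℝ) (γ : ℝ) : ℝ := ∫ σ in Ioo (0 : ℝ) 1, k σ * σ ^ γ

/-- The operator `f ↦ (avg k f)^{1/m}`. For `k = ratioKernel d α m` it is `fixOp` conjugated by the
multiplication with the very singular solution. -/
noncomputable def ratioStep (k : ℝ → ℝ) (m : ℝ) (f : ℝ → ℝ) (z : ℝ) : ℝ := avg k f z ^ (1 / m)

/-- The starting function `(1 - z^{-γ})_+` of the iteration. -/
noncomputable def startRatio (γ z : ℝ) : ℝ := max (1 - z ^ (-γ)) 0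

/-- Continuous nondecreasing functions `(0, ∞) → [0, 1]`: the class that contains all quotients of
iterates by the very singular solution. -/
structure IsRatio (f : ℝ → ℝ) : Prop where
  cont : ContinuousOn f (Ioi 0)
  mono : MonotoneOn f (Ioi 0)
  nonneg : ∀ z, 0 < z → 0 ≤ f z
  le_one : ∀ z, 0 < z → f z ≤ 1

/-! ### Averages against a density on `(0, 1)` -/

section Density

variable {k : ℝ → ℝ}

theorem IsDensity.integrableOn_mul (hk : IsDensity k) {F : ℝ → ℝ} {C : ℝ}
    (hF : ContinuousOn F (Ioo 0 1)) (hC : ∀ σ ∈ Ioo (0 : ℝ) 1, |F σ| ≤ C) :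
    IntegrableOn (fun σ => k σ * F σ) (Ioo 0 1) := by
  refine Integrable.mul_bdd (c := C) hk.integrable
    (hF.aestronglyMeasurable measurableSet_Ioo) ?_
  filter_upwards [ae_restrict_mem measurableSet_Ioo] with σ hσ
  simpa using hC σ hσ

theorem IsDensity.integral_mul_pos (hk : IsDensity k) {F : ℝ → ℝ}
    (hF : ContinuousOn F (Ioo 0 1)) (h0 : ∀ σ ∈ Ioo (0 : ℝ) 1, 0 ≤ F σ)
    (hi : IntegrableOn (fun σ => k σ * F σ) (Ioo 0 1)) {σ₀ : ℝ} (hσ₀ : σ₀ ∈ Ioo (0 : ℝ) 1)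
    (hpos : 0 < F σ₀) : 0 < ∫ σ in Ioo (0 : ℝ) 1, k σ * F σ := by
  rw [setIntegral_pos_iff_support_of_nonneg_ae _ hi]
  · have hopen : IsOpen (Ioo (0 : ℝ) 1 ∩ F ⁻¹' Ioi 0) :=
      hF.isOpen_inter_preimage isOpen_Ioo isOpen_Ioi
    refine lt_of_lt_of_le (hopen.measure_pos volume ⟨σ₀, hσ₀, hpos⟩) (measure_mono ?_)
    rintro σ ⟨hσ, hFσ⟩
    exact ⟨(mul_pos (hk.pos σ hσ) hFσ).ne', hσ⟩
  · filter_upwards [ae_restrict_mem measurableSet_Ioo] with σ hσ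
    exact mul_nonneg (hk.pos σ hσ).le (h0 σ hσ)

/-- Averages of bounded functions converge when the densities and the functions converge
pointwise. As all densities have integral one, pointwise convergence gives convergence in `L¹`
(Scheffé's lemma), and no common dominating function is needed. -/
theorem tendsto_integral_density_mul {ι : Type*} {l : Filter ι} [l.IsCountablyGenerated]
    {K : ι → ℝ → ℝ} (hK : ∀ᶠ i in l, IsDensity (K i)) (hk : IsDensity k)
    (hlim : ∀ σ ∈ Ioo (0 : ℝ) 1, Tendsto (fun i => K i σ) l (𝓝 (k σ)))
    {F : ι → ℝ → ℝ} {F₀ : ℝ → ℝ} (hFc : ∀ᶠ i in l, ContinuousOn (F i) (Ioo 0 1))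
    (hFb : ∀ᶠ i in l, ∀ σ ∈ Ioo (0 : ℝ) 1, |F i σ| ≤ 1)
    (hFlim : ∀ σ ∈ Ioo (0 : ℝ) 1, Tendsto (fun i => F i σ) l (𝓝 (F₀ σ))) :
    Tendsto (fun i => ∫ σ in Ioo (0 : ℝ) 1, K i σ * F i σ) l
      (𝓝 (∫ σ in Ioo (0 : ℝ) 1, k σ * F₀ σ)) := by
  -- the positive part of `k - K i` is dominated by `k`
  have hpos : Tendsto (fun i => ∫ σ in Ioo (0 : ℝ) 1, max (k σ - K i σ) 0) l (𝓝 0) := by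
    suffices h0 : Tendsto (fun i => ∫ σ in Ioo (0 : ℝ) 1, max (k σ - K i σ) 0) l
        (𝓝 (∫ σ in Ioo (0 : ℝ) 1, (0 : ℝ))) by simpa using h0
    refine tendsto_integral_filter_of_dominated_convergence k ?_ ?_ hk.integrable ?_
    · filter_upwards [hK] with i hi
      exact ((hk.integrable.sub hi.integrable).pos_part).aestronglyMeasurable
    · filter_upwards [hK] with i hi
      filter_upwards [ae_restrict_mem measurableSet_Ioo] with σ hσ
      rw [Real.norm_of_nonneg (le_max_right _ _)]
      exact max_le (by linarith [(hi.pos σ hσ).le]) (hk.pos σ hσ).le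
    · filter_upwards [ae_restrict_mem measurableSet_Ioo] with σ hσ
      have := (tendsto_const_nhds.sub (hlim σ hσ)).max (tendsto_const_nhds (x := (0 : ℝ)))
        (f := fun i => k σ - K i σ)
      simpa using this
  have habs : Tendsto (fun i => ∫ σ in Ioo (0 : ℝ) 1, |K i σ - k σ|) l (𝓝 0) := by
    have h2 : Tendsto (fun i => 2 * ∫ σ in Ioo (0 : ℝ) 1, max (k σ - K i σ) 0) l (𝓝 0) := by
      simpa using hpos.const_mul 2
    refine h2.congr' ?_
    filter_upwards [hK] with i hi
    have e : ∀ σ, |K i σ - k σ| = 2 * max (k σ - K i σ) 0 + (K i σ - k σ) := by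
      intro σ
      rcases le_total (k σ) (K i σ) with h | h
      · rw [abs_of_nonneg (by linarith), max_eq_right (by linarith)]; ring
      · rw [abs_of_nonpos (by linarith), max_eq_left (by linarith)]; ring
    have i1 : IntegrableOn (fun σ => 2 * max (k σ - K i σ) 0) (Ioo 0 1) :=
      ((hk.integrable.sub hi.integrable).pos_part).const_mul 2
    have i2 : IntegrableOn (fun σ => K i σ - k σ) (Ioo 0 1) := hi.integrable.sub hk.integrable
    simp_rw [e]
    rw [integral_add i1 i2, integral_sub hi.integrable hk.integrable, hi.integral_eq,
      hk.integral_eq, integral_const_mul]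
    ring
  have hlast : Tendsto (fun i => ∫ σ in Ioo (0 : ℝ) 1, k σ * (F i σ)) l
      (𝓝 (∫ σ in Ioo (0 : ℝ) 1, k σ * F₀ σ)) := by
    refine tendsto_integral_filter_of_dominated_convergence k ?_ ?_ hk.integrable ?_
    · filter_upwards [hFc, hFb] with i hc hb
      exact (hk.integrableOn_mul hc hb).aestronglyMeasurable
    · filter_upwards [hFb] with i hb
      filter_upwards [ae_restrict_mem measurableSet_Ioo] with σ hσ
      rw [norm_mul, Real.norm_of_nonneg (hk.pos σ hσ).le]
      exact mul_le_of_le_one_right (hk.pos σ hσ).le (hb σ hσ)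
    · filter_upwards [ae_restrict_mem measurableSet_Ioo] with σ hσ
      exact (hFlim σ hσ).const_mul _
  have hdiff : Tendsto (fun i => (∫ σ in Ioo (0 : ℝ) 1, K i σ * F i σ) -
      ∫ σ in Ioo (0 : ℝ) 1, k σ * F i σ) l (𝓝 0) := by
    refine squeeze_zero_norm' ?_ habs
    filter_upwards [hK, hFc, hFb] with i hi hc hb
    rw [← integral_sub (hi.integrableOn_mul hc hb) (hk.integrableOn_mul hc hb)]
    refine norm_integral_le_of_norm_le ((hi.integrable.sub hk.integrable).abs) ?_
    filter_upwards [ae_restrict_mem measurableSet_Ioo] with σ hσ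
    rw [← sub_mul, norm_mul]
    exact mul_le_of_le_one_right (norm_nonneg _) (hb σ hσ)
  simpa using hdiff.add hlast

theorem IsDensity.tendsto_integral_mul {ι : Type*} {l : Filter ι} [l.IsCountablyGenerated]
    (hk : IsDensity k)
    {F : ι → ℝ → ℝ} {F₀ : ℝ → ℝ} (hFc : ∀ᶠ i in l, ContinuousOn (F i) (Ioo 0 1))
    (hFb : ∀ᶠ i in l, ∀ σ ∈ Ioo (0 : ℝ) 1, |F i σ| ≤ 1)
    (hFlim : ∀ σ ∈ Ioo (0 : ℝ) 1, Tendsto (fun i => F i σ) l (𝓝 (F₀ σ))) :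
    Tendsto (fun i => ∫ σ in Ioo (0 : ℝ) 1, k σ * F i σ) l
      (𝓝 (∫ σ in Ioo (0 : ℝ) 1, k σ * F₀ σ)) :=
  tendsto_integral_density_mul (K := fun _ => k) (.of_forall fun _ => hk) hk
    (fun _ _ => tendsto_const_nhds) hFc hFb hFlim

theorem continuousOn_rpow_Ioo (γ : ℝ) : ContinuousOn (fun σ : ℝ => σ ^ γ) (Ioo 0 1) :=
  fun _ hσ => (continuousAt_rpow_const _ _ (Or.inl hσ.1.ne')).continuousWithinAt

theorem abs_rpow_le_one {σ γ : ℝ} (hσ : σ ∈ Ioo (0 : ℝ) 1) (hγ : 0 ≤ γ) : |σ ^ γ| ≤ 1 := by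
  rw [abs_of_nonneg (rpow_nonneg hσ.1.le _)]
  exact rpow_le_one hσ.1.le hσ.2.le hγ

theorem IsDensity.integrableOn_rpow (hk : IsDensity k) {γ : ℝ} (hγ : 0 ≤ γ) :
    IntegrableOn (fun σ => k σ * σ ^ γ) (Ioo 0 1) :=
  hk.integrableOn_mul (continuousOn_rpow_Ioo γ) fun _ hσ => abs_rpow_le_one hσ hγ

theorem IsDensity.moment_pos (hk : IsDensity k) {γ : ℝ} (hγ : 0 ≤ γ) : 0 < moment k γ :=
  hk.integral_mul_pos (continuousOn_rpow_Ioo γ) (fun _ hσ => rpow_nonneg hσ.1.le _)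
    (hk.integrableOn_rpow hγ) (σ₀ := 1 / 2) (by norm_num) (by positivity)

theorem IsDensity.moment_strictAnti (hk : IsDensity k) {γ γ' : ℝ} (hγ : 0 ≤ γ) (h : γ < γ') :
    moment k γ' < moment k γ := by
  have hγ' : 0 ≤ γ' := hγ.trans h.le
  rw [← sub_pos, moment, moment,
    ← integral_sub (hk.integrableOn_rpow hγ) (hk.integrableOn_rpow hγ')]
  simp_rw [← mul_sub]
  refine hk.integral_mul_pos ((continuousOn_rpow_Ioo γ).sub (continuousOn_rpow_Ioo γ')) ?_ ?_
    (σ₀ := 1 / 2) (by norm_num) ?_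
  · intro σ hσ
    exact sub_nonneg.2 (rpow_le_rpow_of_exponent_ge hσ.1 hσ.2.le h.le)
  · simp_rw [mul_sub]
    exact (hk.integrableOn_rpow hγ).sub (hk.integrableOn_rpow hγ')
  · exact sub_pos.2 (rpow_lt_rpow_of_exponent_gt (by norm_num) (by norm_num) h)

theorem IsDensity.moment_zero (hk : IsDensity k) : moment k 0 = 1 := by
  simp [moment, hk.integral_eq]

theorem IsDensity.continuousOn_moment (hk : IsDensity k) : ContinuousOn (moment k) (Ici 0) := by
  intro γ₀ hγ₀
  refine hk.tendsto_integral_mul (.of_forall fun γ => continuousOn_rpow_Ioo γ) ?_ ?_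
  · filter_upwards [self_mem_nhdsWithin] with γ hγ σ hσ
    exact abs_rpow_le_one hσ hγ
  · intro σ hσ
    exact ((continuousAt_const_rpow hσ.1.ne').tendsto).mono_left nhdsWithin_le_nhds

theorem IsDensity.tendsto_moment_atTop (hk : IsDensity k) : Tendsto (moment k) atTop (𝓝 0) := by
  have h0 : (0 : ℝ) = ∫ σ in Ioo (0 : ℝ) 1, k σ * (0 : ℝ) := by simp
  rw [h0]
  refine hk.tendsto_integral_mul (.of_forall fun γ => continuousOn_rpow_Ioo γ) ?_ ?_
  · filter_upwards [eventually_ge_atTop 0] with γ hγ σ hσ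
    exact abs_rpow_le_one hσ hγ
  · intro σ hσ
    exact tendsto_rpow_atTop_of_base_lt_one σ (by linarith [hσ.1]) hσ.2

/-- Every value in `(0, 1)` is taken by exactly one moment of positive order. -/
theorem IsDensity.existsUnique_moment_eq (hk : IsDensity k) {m : ℝ} (hm : 0 < m) (hm1 : m < 1) :
    ∃ γ, 0 < γ ∧ moment k γ = m ∧ ∀ γ', 0 < γ' → moment k γ' = m → γ' = γ := by
  obtain ⟨N, hN, hNm⟩ := ((hk.tendsto_moment_atTop.eventually_lt_const hm).and
    (eventually_ge_atTop 0)).exists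
  obtain ⟨γ, hγ, hγm⟩ := intermediate_value_Icc' hNm
    (hk.continuousOn_moment.mono fun x hx => hx.1) ⟨hN.le, by rw [hk.moment_zero]; exact hm1.le⟩
  have hγ0 : 0 < γ := by
    rcases hγ.1.eq_or_lt with h | h
    · rw [← h, hk.moment_zero] at hγm; exact absurd hγm hm1.ne'
    · exact h
  refine ⟨γ, hγ0, hγm, fun γ' hγ' h => ?_⟩
  rcases lt_trichotomy γ' γ with h1 | h1 | h1
  · linarith [hk.moment_strictAnti hγ'.le h1]
  · exact h1
  · linarith [hk.moment_strictAnti hγ0.le h1]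

theorem IsRatio.continuousOn_comp_div {f : ℝ → ℝ} (hf : IsRatio f) {z : ℝ} (hz : 0 < z) :
    ContinuousOn (fun σ => f (z / σ)) (Ioo 0 1) := by
  refine hf.cont.comp (continuousOn_const.div continuousOn_id fun σ hσ => hσ.1.ne') ?_
  exact fun σ hσ => div_pos hz hσ.1

theorem IsRatio.abs_le_one {f : ℝ → ℝ} (hf : IsRatio f) {z : ℝ} (hz : 0 < z) : |f z| ≤ 1 := by
  rw [abs_of_nonneg (hf.nonneg z hz)]; exact hf.le_one z hz

theorem IsDensity.integrableOn_avg (hk : IsDensity k) {f : ℝ → ℝ} (hf : IsRatio f) {z : ℝ}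
    (hz : 0 < z) : IntegrableOn (fun σ => k σ * f (z / σ)) (Ioo 0 1) :=
  hk.integrableOn_mul (hf.continuousOn_comp_div hz) fun _ hσ => hf.abs_le_one (div_pos hz hσ.1)

theorem IsDensity.avg_nonneg (hk : IsDensity k) {f : ℝ → ℝ} (hf : IsRatio f) {z : ℝ}
    (hz : 0 < z) : 0 ≤ avg k f z :=
  setIntegral_nonneg measurableSet_Ioo fun σ hσ =>
    mul_nonneg (hk.pos σ hσ).le (hf.nonneg _ (div_pos hz hσ.1))

theorem IsDensity.avg_le_one (hk : IsDensity k) {f : ℝ → ℝ} (hf : IsRatio f) {z : ℝ}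
    (hz : 0 < z) : avg k f z ≤ 1 := by
  rw [← hk.integral_eq]
  refine setIntegral_mono_on (hk.integrableOn_avg hf hz) hk.integrable measurableSet_Ioo ?_
  exact fun σ hσ => mul_le_of_le_one_right (hk.pos σ hσ).le (hf.le_one _ (div_pos hz hσ.1))

theorem IsDensity.avg_mono (hk : IsDensity k) {f : ℝ → ℝ} (hf : IsRatio f) {z w : ℝ}
    (hz : 0 < z) (hzw : z ≤ w) : avg k f z ≤ avg k f w := by
  have hw := hz.trans_le hzw
  refine setIntegral_mono_on (hk.integrableOn_avg hf hz) (hk.integrableOn_avg hf hw)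
    measurableSet_Ioo ?_
  intro σ hσ
  refine mul_le_mul_of_nonneg_left (hf.mono (div_pos hz hσ.1) (div_pos hw hσ.1) ?_)
    (hk.pos σ hσ).le
  exact div_le_div_of_nonneg_right hzw hσ.1.le

theorem IsDensity.continuousOn_avg (hk : IsDensity k) {f : ℝ → ℝ} (hf : IsRatio f) :
    ContinuousOn (avg k f) (Ioi 0) := by
  intro z₀ hz₀
  refine hk.tendsto_integral_mul ?_ ?_ ?_
  · filter_upwards [self_mem_nhdsWithin] with z hz using hf.continuousOn_comp_div hz
  · filter_upwards [self_mem_nhdsWithin] with z hz σ hσ using hf.abs_le_one (div_pos hz hσ.1)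
  · intro σ hσ
    have h1 : ContinuousWithinAt (fun z => f (z / σ)) (Ioi 0) z₀ := by
      refine ContinuousWithinAt.comp (t := Ioi 0) (hf.cont _ (div_pos hz₀ hσ.1)) ?_ ?_
      · exact (continuous_id.div_const σ).continuousWithinAt
      · exact fun z hz => div_pos hz hσ.1
    exact h1

theorem IsRatio.step (hk : IsDensity k) {m : ℝ} (hm : 0 < m) {f : ℝ → ℝ} (hf : IsRatio f) :
    IsRatio (ratioStep k m f) where
  cont := (hk.continuousOn_avg hf).rpow_const fun z _ => Or.inr (by positivity)
  mono z hz w _ hzw :=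
    rpow_le_rpow (hk.avg_nonneg hf hz) (hk.avg_mono hf hz hzw) (by positivity)
  nonneg z hz := rpow_nonneg (hk.avg_nonneg hf hz) _
  le_one z hz := rpow_le_one (hk.avg_nonneg hf hz) (hk.avg_le_one hf hz) (by positivity)

theorem ratioStep_rpow (hk : IsDensity k) {m : ℝ} (hm : 0 < m) {f : ℝ → ℝ} (hf : IsRatio f)
    {z : ℝ} (hz : 0 < z) : ratioStep k m f z ^ m = avg k f z := by
  rw [ratioStep, ← rpow_mul (hk.avg_nonneg hf hz), one_div_mul_cancel hm.ne', rpow_one]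

/-! ### The contraction in the weighted norm `sup z^e |f(z)|` -/

theorem rpow_sub_rpow_le {q a b : ℝ} (hq : 1 ≤ q) (hb : 0 ≤ b) (hba : b ≤ a) (ha : a ≤ 1) :
    a ^ q - b ^ q ≤ q * (a - b) := by
  rcases (hb.trans hba).eq_or_lt with h | h
  · have : b = 0 := by linarith
    simp [← h, this]
  have h1 := one_add_mul_self_le_rpow_one_add (s := b / a - 1) (by linarith [div_nonneg hb h.le]) hq
  rw [add_sub_cancel, div_rpow hb h.le, le_div_iff₀ (rpow_pos_of_pos h q)] at h1
  have h2 : a ^ q ≤ a := by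
    simpa using rpow_le_rpow_of_exponent_ge h ha hq
  have h3 : (1 + q * (b / a - 1)) * a ^ q = a ^ q - q * (a - b) * (a ^ q / a) := by
    field_simp; ring
  have h4 : a ^ q / a ≤ 1 := (div_le_one h).2 h2
  have h5 : q * (a - b) * (a ^ q / a) ≤ q * (a - b) :=
    mul_le_of_le_one_right (mul_nonneg (by linarith) (by linarith)) h4
  linarith

theorem abs_rpow_sub_rpow_le {q a b : ℝ} (hq : 1 ≤ q) (ha0 : 0 ≤ a) (hb0 : 0 ≤ b) (ha : a ≤ 1)
    (hb : b ≤ 1) : |a ^ q - b ^ q| ≤ q * |a - b| := by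
  rcases le_total b a with h | h
  · rw [abs_of_nonneg (sub_nonneg.2 h),
      abs_of_nonneg (sub_nonneg.2 (rpow_le_rpow hb0 h (by linarith)))]
    exact rpow_sub_rpow_le hq hb0 h ha
  · rw [abs_sub_comm, abs_sub_comm a, abs_of_nonneg (sub_nonneg.2 h),
      abs_of_nonneg (sub_nonneg.2 (rpow_le_rpow ha0 h (by linarith)))]
    exact rpow_sub_rpow_le hq ha0 h hb

theorem div_rpow_neg {z σ e : ℝ} (hz : 0 < z) (hσ : 0 < σ) :
    (z / σ) ^ (-e) = σ ^ e * z ^ (-e) := by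
  rw [div_rpow hz.le hσ.le, rpow_neg hσ.le, div_inv_eq_mul, mul_comm]

/-- The power `1/m` is `1/m`-Lipschitz on `[0, 1]`, and averaging multiplies the weight `z^{-e}` by
the moment of order `e`. -/
theorem abs_ratioStep_sub_le (hk : IsDensity k) {m : ℝ} (hm : 0 < m) (hm1 : m < 1)
    {f g : ℝ → ℝ} (hf : IsRatio f) (hg : IsRatio g) {e C : ℝ} (he : 0 ≤ e)
    (h : ∀ z, 0 < z → |f z - g z| ≤ C * z ^ (-e)) {z : ℝ} (hz : 0 < z) :
    |ratioStep k m f z - ratioStep k m g z| ≤ C * (moment k e / m) * z ^ (-e) := by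
  have h1 : |avg k f z - avg k g z| ≤ C * moment k e * z ^ (-e) := by
    rw [avg, avg, ← integral_sub (hk.integrableOn_avg hf hz) (hk.integrableOn_avg hg hz)]
    have h2 : C * moment k e * z ^ (-e) =
        ∫ σ in Ioo (0 : ℝ) 1, (C * z ^ (-e)) * (k σ * σ ^ e) := by
      rw [integral_const_mul, moment]; ring
    rw [h2, ← Real.norm_eq_abs]
    refine norm_integral_le_of_norm_le ((hk.integrableOn_rpow he).const_mul _) ?_
    filter_upwards [ae_restrict_mem measurableSet_Ioo] with σ hσ
    rw [← mul_sub, norm_mul, Real.norm_of_nonneg (hk.pos σ hσ).le]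
    have h3 := h (z / σ) (div_pos hz hσ.1)
    rw [div_rpow_neg hz hσ.1] at h3
    calc k σ * |f (z / σ) - g (z / σ)| ≤ k σ * (C * (σ ^ e * z ^ (-e))) :=
          mul_le_mul_of_nonneg_left h3 (hk.pos σ hσ).le
      _ = _ := by ring
  have h4 := abs_rpow_sub_rpow_le (q := 1 / m) ((one_le_div hm).2 hm1.le) (hk.avg_nonneg hf hz)
    (hk.avg_nonneg hg hz) (hk.avg_le_one hf hz) (hk.avg_le_one hg hz)
  calc _ ≤ 1 / m * |avg k f z - avg k g z| := h4
    _ ≤ 1 / m * (C * moment k e * z ^ (-e)) := by gcongr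
    _ = _ := by ring

theorem IsRatio.iterate (hk : IsDensity k) {m : ℝ} (hm : 0 < m) {f : ℝ → ℝ} (hf : IsRatio f)
    (n : ℕ) : IsRatio ((ratioStep k m)^[n] f) := by
  induction n with
  | zero => exact hf
  | succ n ih => rw [Function.iterate_succ_apply']; exact ih.step hk hm

theorem abs_iterate_sub_le (hk : IsDensity k) {m : ℝ} (hm : 0 < m) (hm1 : m < 1)
    {f g : ℝ → ℝ} (hf : IsRatio f) (hg : IsRatio g) {e C : ℝ} (he : 0 ≤ e)
    (h : ∀ z, 0 < z → |f z - g z| ≤ C * z ^ (-e)) (n : ℕ) {z : ℝ} (hz : 0 < z) :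
    |(ratioStep k m)^[n] f z - (ratioStep k m)^[n] g z|
      ≤ C * (moment k e / m) ^ n * z ^ (-e) := by
  induction n generalizing z with
  | zero => simpa using h z hz
  | succ n ih =>
    rw [Function.iterate_succ_apply', Function.iterate_succ_apply']
    refine (abs_ratioStep_sub_le hk hm hm1 (hf.iterate hk hm n) (hg.iterate hk hm n) he
      (fun z hz => ih hz) hz).trans_eq ?_
    ring

end Density

/-! ### The fixed point of the averaging operator with prescribed tail -/

/-- A density on `(0, 1)` whose moment of order `γ` is `m`. Then `1 - z^{-γ}` solves the fixed point
equation `f^m = avg k f`, linearised at `f = 1`. -/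
structure IsTailKernel (k : ℝ → ℝ) (m γ : ℝ) : Prop extends IsDensity k where
  m_pos : 0 < m
  m_lt_one : m < 1
  exponent_pos : 0 < γ
  moment_eq : moment k γ = m

/-- The limit of the iterates of `ratioStep` on `startRatio`. -/
noncomputable def limitRatio (k : ℝ → ℝ) (m γ z : ℝ) : ℝ :=
  limUnder atTop fun n : ℕ => (ratioStep k m)^[n] (startRatio γ) z

theorem isRatio_startRatio {γ : ℝ} (hγ : 0 < γ) : IsRatio (startRatio γ) where
  cont := by
    refine ContinuousOn.sup (continuousOn_const.sub ?_) continuousOn_const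
    exact fun z hz => (continuousAt_rpow_const _ _ (Or.inl (ne_of_gt hz))).continuousWithinAt
  mono z hz w _ hzw := by
    have := rpow_le_rpow_of_nonpos hz hzw (neg_nonpos.2 hγ.le)
    exact max_le_max (by linarith) le_rfl
  nonneg _ _ := le_max_right _ _
  le_one z hz := max_le (by linarith [rpow_nonneg hz.le (-γ)]) zero_le_one

theorem startRatio_of_one_le {γ z : ℝ} (hγ : 0 < γ) (hz : 1 ≤ z) :
    startRatio γ z = 1 - z ^ (-γ) :=
  max_eq_left (sub_nonneg.2 (rpow_le_one_of_one_le_of_nonpos hz (neg_nonpos.2 hγ.le)))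

theorem rpow_neg_two_mul {γ z : ℝ} (hz : 0 < z) : z ^ (-(2 * γ)) = (z ^ (-γ)) ^ 2 := by
  rw [← rpow_natCast, ← rpow_mul hz.le]; congr 1; push_cast; ring

theorem IsRatio.abs_sub_le_one {f g : ℝ → ℝ} (hf : IsRatio f) (hg : IsRatio g) {z : ℝ}
    (hz : 0 < z) : |f z - g z| ≤ 1 :=
  abs_sub_le_iff.2 ⟨by linarith [hf.le_one z hz, hg.nonneg z hz],
    by linarith [hg.le_one z hz, hf.nonneg z hz]⟩

/-- Two members of the class are `z^{-2γ}`-close as soon as they are so for `z ≥ 1`. -/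
theorem IsRatio.abs_sub_le_of_one_le {f g : ℝ → ℝ} (hf : IsRatio f) (hg : IsRatio g) {γ : ℝ}
    (hγ : 0 < γ) (h : ∀ z, 1 ≤ z → |f z - g z| ≤ z ^ (-(2 * γ))) {z : ℝ} (hz : 0 < z) :
    |f z - g z| ≤ z ^ (-(2 * γ)) := by
  rcases le_total 1 z with h1 | h1
  · exact h z h1
  · exact (hf.abs_sub_le_one hg hz).trans
      (one_le_rpow_of_pos_of_le_one_of_nonpos hz h1 (by linarith))

theorem one_add_inv_le {y : ℝ} (hy : 0 ≤ y) : (1 + y)⁻¹ ≤ 1 - y + y ^ 2 := by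
  rw [inv_le_iff_one_le_mul₀ (by linarith)]
  nlinarith [pow_nonneg hy 3]

namespace IsTailKernel

variable {k : ℝ → ℝ} {m γ : ℝ}

theorem ratio_nonneg (h : IsTailKernel k m γ) : 0 ≤ moment k (2 * γ) / m :=
  div_nonneg (h.toIsDensity.moment_pos (by linarith [h.exponent_pos])).le h.m_pos.le

theorem ratio_lt_one (h : IsTailKernel k m γ) : moment k (2 * γ) / m < 1 := by
  rw [div_lt_one h.m_pos]
  calc moment k (2 * γ) < moment k γ :=
        h.toIsDensity.moment_strictAnti h.exponent_pos.le (by linarith [h.exponent_pos])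
    _ = m := h.moment_eq

theorem avg_startRatio (h : IsTailKernel k m γ) {z : ℝ} (hz : 1 ≤ z) :
    avg k (startRatio γ) z = 1 - m * z ^ (-γ) := by
  have hz0 : 0 < z := by linarith
  have h1 : avg k (startRatio γ) z =
      ∫ σ in Ioo (0 : ℝ) 1, (k σ - z ^ (-γ) * (k σ * σ ^ γ)) := by
    refine setIntegral_congr_fun measurableSet_Ioo fun σ hσ => ?_
    have : 1 ≤ z / σ := (one_le_div hσ.1).2 (hσ.2.le.trans hz)
    rw [startRatio_of_one_le h.exponent_pos this, div_rpow_neg hz0 hσ.1]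
    ring
  rw [h1, integral_sub h.integrable
    ((h.toIsDensity.integrableOn_rpow h.exponent_pos.le).const_mul _), h.integral_eq,
    integral_const_mul]
  change 1 - z ^ (-γ) * moment k γ = _
  rw [h.moment_eq]; ring

/-- Bernoulli's inequality: `startRatio` is a subsolution. -/
theorem startRatio_le_ratioStep (h : IsTailKernel k m γ) {z : ℝ} (hz : 0 < z) :
    startRatio γ z ≤ ratioStep k m (startRatio γ) z := by
  have hs := isRatio_startRatio h.exponent_pos
  refine max_le ?_ ((hs.step h.toIsDensity h.m_pos).nonneg z hz)
  rcases le_total z 1 with h1 | h1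
  · have := one_le_rpow_of_pos_of_le_one_of_nonpos hz h1 (neg_nonpos.2 h.exponent_pos.le)
    linarith [(hs.step h.toIsDensity h.m_pos).nonneg z hz]
  rw [ratioStep, h.avg_startRatio h1]
  have hy0 : 0 ≤ z ^ (-γ) := rpow_nonneg hz.le _
  have hy1 : z ^ (-γ) ≤ 1 := rpow_le_one_of_one_le_of_nonpos h1 (by linarith [h.exponent_pos])
  set y := z ^ (-γ)
  have hm := h.m_pos
  have hmy : m * y ≤ 1 := mul_le_one₀ h.m_lt_one.le hy0 hy1
  have hq : 1 ≤ 1 / m := (one_le_div hm).2 h.m_lt_one.le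
  have e : 1 / m * (m * y) = y := by field_simp
  have := one_add_mul_self_le_rpow_one_add (s := -(m * y)) (by linarith) hq
  rw [mul_neg, e] at this
  simpa [sub_eq_add_neg] using this

theorem abs_ratioStep_startRatio_sub_le (h : IsTailKernel k m γ) {z : ℝ} (hz : 0 < z) :
    |ratioStep k m (startRatio γ) z - startRatio γ z| ≤ z ^ (-(2 * γ)) := by
  have hs := isRatio_startRatio h.exponent_pos
  refine (hs.step h.toIsDensity h.m_pos).abs_sub_le_of_one_le hs h.exponent_pos
    (fun z hz => ?_) hz
  have hz0 : 0 < z := by linarith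
  have lower := h.startRatio_le_ratioStep hz0
  rw [ratioStep, h.avg_startRatio hz, startRatio_of_one_le h.exponent_pos hz] at lower
  rw [rpow_neg_two_mul hz0, ratioStep, h.avg_startRatio hz, startRatio_of_one_le h.exponent_pos hz]
  have hy0 : 0 ≤ z ^ (-γ) := rpow_nonneg hz0.le _
  have hy1 : z ^ (-γ) ≤ 1 := rpow_le_one_of_one_le_of_nonpos hz (by linarith [h.exponent_pos])
  set y := z ^ (-γ)
  have hm := h.m_pos
  have hmy : m * y ≤ 1 := mul_le_one₀ h.m_lt_one.le hy0 hy1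
  have hmy0 : 0 ≤ m * y := mul_nonneg hm.le hy0
  have hq : 1 ≤ 1 / m := (one_le_div hm).2 h.m_lt_one.le
  have e : 1 / m * (m * y) = y := by field_simp
  have upper : (1 - m * y) ^ (1 / m) ≤ 1 - y + y ^ 2 := by
    have h1 := one_add_mul_self_le_rpow_one_add (s := m * y) (by linarith) hq
    rw [e] at h1
    have h2 : 1 - m * y ≤ (1 + m * y)⁻¹ := by
      rw [← one_div, le_div_iff₀ (by linarith)]
      nlinarith
    calc (1 - m * y) ^ (1 / m) ≤ ((1 + m * y)⁻¹) ^ (1 / m) :=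
          rpow_le_rpow (by linarith) h2 (by positivity)
      _ = ((1 + m * y) ^ (1 / m))⁻¹ := inv_rpow (by linarith) _
      _ ≤ (1 + y)⁻¹ := inv_anti₀ (by linarith) h1
      _ ≤ _ := one_add_inv_le hy0
  rw [abs_le]
  constructor <;> nlinarith

theorem dist_iterate_succ_le (h : IsTailKernel k m γ) (n : ℕ) {z : ℝ} (hz : 0 < z) :
    dist ((ratioStep k m)^[n] (startRatio γ) z) ((ratioStep k m)^[n + 1] (startRatio γ) z)
      ≤ z ^ (-(2 * γ)) * (moment k (2 * γ) / m) ^ n := by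
  have hs := isRatio_startRatio h.exponent_pos
  rw [dist_comm, Real.dist_eq, Function.iterate_succ_apply]
  refine (abs_iterate_sub_le h.toIsDensity h.m_pos h.m_lt_one (hs.step h.toIsDensity h.m_pos) hs
    (C := 1) (e := 2 * γ) (by linarith [h.exponent_pos])
    (fun z hz => by simpa using h.abs_ratioStep_startRatio_sub_le hz) n hz).trans_eq ?_
  ring

theorem tendsto_iterate (h : IsTailKernel k m γ) {z : ℝ} (hz : 0 < z) :
    Tendsto (fun n : ℕ => (ratioStep k m)^[n] (startRatio γ) z) atTop
      (𝓝 (limitRatio k m γ z)) :=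
  (cauchySeq_of_le_geometric _ _ h.ratio_lt_one fun n =>
    h.dist_iterate_succ_le n hz).tendsto_limUnder

theorem abs_iterate_sub_limitRatio_le (h : IsTailKernel k m γ) (n : ℕ) {z : ℝ} (hz : 0 < z) :
    |(ratioStep k m)^[n] (startRatio γ) z - limitRatio k m γ z|
      ≤ z ^ (-(2 * γ)) * (moment k (2 * γ) / m) ^ n / (1 - moment k (2 * γ) / m) :=
  dist_le_of_le_geometric_of_tendsto _ _ h.ratio_lt_one
    (fun n => h.dist_iterate_succ_le n hz) (h.tendsto_iterate hz) n

theorem isRatio_limitRatio (h : IsTailKernel k m γ) : IsRatio (limitRatio k m γ) := by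
  have hs := fun n => (isRatio_startRatio h.exponent_pos).iterate h.toIsDensity h.m_pos n
  refine ⟨?_, ?_, ?_, ?_⟩
  · have hloc : TendstoLocallyUniformlyOn (fun n : ℕ => (ratioStep k m)^[n] (startRatio γ))
        (limitRatio k m γ) atTop (Ioi 0) := by
      rw [Metric.tendstoLocallyUniformlyOn_iff]
      intro ε hε z₀ (hz₀ : 0 < z₀)
      refine ⟨Ioi (z₀ / 2), mem_nhdsWithin_of_mem_nhds (Ioi_mem_nhds (by linarith)), ?_⟩
      have hlim : Tendsto (fun n : ℕ => (z₀ / 2) ^ (-(2 * γ)) * (moment k (2 * γ) / m) ^ n /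
          (1 - moment k (2 * γ) / m)) atTop (𝓝 0) := by
        simpa using ((tendsto_pow_atTop_nhds_zero_of_lt_one h.ratio_nonneg
          h.ratio_lt_one).const_mul ((z₀ / 2) ^ (-(2 * γ)))).div_const _
      filter_upwards [hlim.eventually_lt_const hε] with n hn z hz
      have hz0 : 0 < z := lt_trans (by linarith) hz
      rw [dist_comm]
      refine ((h.abs_iterate_sub_limitRatio_le n hz0).trans ?_).trans_lt hn
      have := h.ratio_lt_one
      have := h.ratio_nonneg
      refine div_le_div_of_nonneg_right (mul_le_mul_of_nonneg_right ?_ (by positivity))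
        (by linarith)
      exact rpow_le_rpow_of_nonpos (by linarith) (le_of_lt hz) (by linarith [h.exponent_pos])
    exact hloc.continuousOn (.of_forall fun n => (hs n).cont)
  · intro z hz w hw hzw
    exact le_of_tendsto_of_tendsto' (h.tendsto_iterate hz) (h.tendsto_iterate hw)
      fun n => (hs n).mono hz hw hzw
  · exact fun z hz => ge_of_tendsto' (h.tendsto_iterate hz) fun n => (hs n).nonneg z hz
  · exact fun z hz => le_of_tendsto' (h.tendsto_iterate hz) fun n => (hs n).le_one z hz

theorem iterate_le_limitRatio (h : IsTailKernel k m γ) (n : ℕ) {z : ℝ} (hz : 0 < z) :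
    (ratioStep k m)^[n] (startRatio γ) z ≤ limitRatio k m γ z := by
  have hs := fun n => (isRatio_startRatio h.exponent_pos).iterate h.toIsDensity h.m_pos n
  have hmono : ∀ n : ℕ, ∀ z, 0 < z →
      (ratioStep k m)^[n] (startRatio γ) z ≤ (ratioStep k m)^[n + 1] (startRatio γ) z := by
    intro n
    induction n with
    | zero => exact fun z hz => h.startRatio_le_ratioStep hz
    | succ n ih =>
      intro z hz
      rw [Function.iterate_succ_apply', Function.iterate_succ_apply' _ (n + 1)]
      refine rpow_le_rpow (h.toIsDensity.avg_nonneg (hs n) hz) ?_ (by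
        have := h.m_pos
        positivity)
      refine setIntegral_mono_on (h.toIsDensity.integrableOn_avg (hs n) hz)
        (h.toIsDensity.integrableOn_avg (hs (n + 1)) hz) measurableSet_Ioo fun σ hσ => ?_
      exact mul_le_mul_of_nonneg_left (ih _ (div_pos hz hσ.1)) (h.pos σ hσ).le
  exact (monotone_nat_of_le_succ fun n => hmono n z hz).ge_of_tendsto (h.tendsto_iterate hz) n

theorem tendsto_mul_ratio_pow (h : IsTailKernel k m γ) (C : ℝ) :
    Tendsto (fun n : ℕ => C * (moment k (2 * γ) / m) ^ n) atTop (𝓝 0) := by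
  simpa using (tendsto_pow_atTop_nhds_zero_of_lt_one h.ratio_nonneg h.ratio_lt_one).const_mul C

theorem abs_startRatio_sub_limitRatio_le (h : IsTailKernel k m γ) {z : ℝ} (hz : 0 < z) :
    |startRatio γ z - limitRatio k m γ z| ≤ (1 - moment k (2 * γ) / m)⁻¹ * z ^ (-(2 * γ)) := by
  refine (h.abs_iterate_sub_limitRatio_le 0 hz).trans_eq ?_
  rw [pow_zero, mul_one, div_eq_mul_inv, mul_comm]

/-- A fixed point of `ratioStep` at weighted distance `O(z^{-2γ})` from `startRatio` is the limit of
the iterates. -/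
theorem eq_limitRatio (h : IsTailKernel k m γ) {f : ℝ → ℝ} (hf : IsRatio f)
    (hfix : ∀ z, 0 < z → ratioStep k m f z = f z) {C : ℝ}
    (hC : ∀ z, 0 < z → |startRatio γ z - f z| ≤ C * z ^ (-(2 * γ))) {z : ℝ} (hz : 0 < z) :
    limitRatio k m γ z = f z := by
  have hiter : ∀ n : ℕ, ∀ z, 0 < z → (ratioStep k m)^[n] f z = f z := by
    intro n
    induction n with
    | zero => simp
    | succ n ih =>
      intro z hz
      rw [Function.iterate_succ_apply', ← hfix z hz, ratioStep, ratioStep, avg, avg]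
      congr 1
      refine setIntegral_congr_fun measurableSet_Ioo fun σ hσ => ?_
      rw [ih _ (div_pos hz hσ.1)]
  refine tendsto_nhds_unique (h.tendsto_iterate hz) (tendsto_sub_nhds_zero_iff.1 ?_)
  refine squeeze_zero_norm (fun n => ?_) (h.tendsto_mul_ratio_pow (C * z ^ (-(2 * γ))))
  have := abs_iterate_sub_le h.toIsDensity h.m_pos h.m_lt_one
    (isRatio_startRatio h.exponent_pos) hf (by linarith [h.exponent_pos]) hC n hz
  rw [hiter n z hz] at this
  rw [Real.norm_eq_abs]
  linarith

theorem ratioStep_limitRatio (h : IsTailKernel k m γ) {z : ℝ} (hz : 0 < z) :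
    ratioStep k m (limitRatio k m γ) z = limitRatio k m γ z := by
  have h1 := (tendsto_add_atTop_iff_nat 1).2 (h.tendsto_iterate hz)
  refine (tendsto_nhds_unique h1 (tendsto_sub_nhds_zero_iff.1 ?_)).symm
  refine squeeze_zero_norm (a := fun n => (moment k (2 * γ) / m) ^ n /
    (1 - moment k (2 * γ) / m) * (moment k (2 * γ) / m) * z ^ (-(2 * γ))) (fun n => ?_) ?_
  · rw [Function.iterate_succ_apply', Real.norm_eq_abs]
    exact abs_ratioStep_sub_le h.toIsDensity h.m_pos h.m_lt_one
      ((isRatio_startRatio h.exponent_pos).iterate h.toIsDensity h.m_pos n) h.isRatio_limitRatio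
      (e := 2 * γ) (C := (moment k (2 * γ) / m) ^ n / (1 - moment k (2 * γ) / m))
      (by linarith [h.exponent_pos])
      (fun z hz => (h.abs_iterate_sub_limitRatio_le n hz).trans_eq (by ring)) hz
  have := h.tendsto_mul_ratio_pow
    ((1 - moment k (2 * γ) / m)⁻¹ * (moment k (2 * γ) / m) * z ^ (-(2 * γ)))
  refine this.congr fun n => ?_
  ring

theorem limitRatio_rpow (h : IsTailKernel k m γ) {z : ℝ} (hz : 0 < z) :
    limitRatio k m γ z ^ m = avg k (limitRatio k m γ) z := by
  rw [← ratioStep_rpow h.toIsDensity h.m_pos h.isRatio_limitRatio hz, h.ratioStep_limitRatio hz]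

/-! ### Properties of the fixed point -/

theorem limitRatio_sub_isLittleO (h : IsTailKernel k m γ) :
    (fun z => limitRatio k m γ z - 1 + z ^ (-γ)) =o[atTop] fun z : ℝ => z ^ (-γ) := by
  have hγ := h.exponent_pos
  have h1 : (fun z => limitRatio k m γ z - 1 + z ^ (-γ)) =O[atTop]
      fun z : ℝ => z ^ (-(2 * γ)) := by
    refine IsBigO.of_bound (1 - moment k (2 * γ) / m)⁻¹ ?_
    filter_upwards [eventually_ge_atTop 1] with z hz
    have hz0 : 0 < z := by linarith
    have := h.abs_startRatio_sub_limitRatio_le hz0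
    rw [startRatio_of_one_le hγ hz, abs_sub_comm] at this
    rw [Real.norm_eq_abs, Real.norm_of_nonneg (rpow_nonneg hz0.le _)]
    convert this using 2
    ring
  refine h1.trans_isLittleO ?_
  rw [isLittleO_iff_tendsto']
  · refine (tendsto_rpow_neg_atTop hγ).congr' ?_
    filter_upwards [eventually_gt_atTop 0] with z hz
    rw [rpow_neg_two_mul hz, sq, mul_div_assoc, div_self (rpow_pos_of_pos hz _).ne', mul_one]
  · filter_upwards [eventually_gt_atTop 0] with z hz h0
    exact absurd h0 (rpow_pos_of_pos hz _).ne'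

theorem tendsto_limitRatio_atTop (h : IsTailKernel k m γ) :
    Tendsto (limitRatio k m γ) atTop (𝓝 1) := by
  have h0 := tendsto_rpow_neg_atTop h.exponent_pos
  have h1 := h.limitRatio_sub_isLittleO.isBigO.trans_tendsto h0
  have := (h1.sub h0).add_const 1
  simpa using this

theorem limitRatio_pos (h : IsTailKernel k m γ) {z : ℝ} (hz : 0 < z) :
    0 < limitRatio k m γ z := by
  obtain ⟨w, hw, hwz⟩ := ((h.tendsto_limitRatio_atTop.eventually_const_lt zero_lt_one).and
    (eventually_gt_atTop z)).exists
  have hV := h.isRatio_limitRatio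
  have hw0 : 0 < w := hz.trans hwz
  have h1 : 0 < avg k (limitRatio k m γ) z := by
    refine h.toIsDensity.integral_mul_pos (hV.continuousOn_comp_div hz)
      (fun σ hσ => hV.nonneg _ (div_pos hz hσ.1)) (h.toIsDensity.integrableOn_avg hV hz)
      (σ₀ := z / w) ⟨div_pos hz hw0, (div_lt_one hw0).2 hwz⟩ ?_
    rwa [div_div_cancel₀ hz.ne']
  rw [← h.ratioStep_limitRatio hz]
  exact rpow_pos_of_pos h1 _

theorem limitRatio_lt_one (h : IsTailKernel k m γ) {z : ℝ} (hz : 0 < z) :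
    limitRatio k m γ z < 1 := by
  have h1 := h.limitRatio_sub_isLittleO.def (c := 1 / 2) (by norm_num)
  obtain ⟨w, hw, hwz⟩ := (h1.and (eventually_ge_atTop z)).exists
  have hw0 : 0 < w := hz.trans_le hwz
  have hy : 0 < w ^ (-γ) := rpow_pos_of_pos hw0 _
  rw [Real.norm_eq_abs, Real.norm_of_nonneg hy.le] at hw
  have := h.isRatio_limitRatio.mono hz hw0 hwz
  have := (abs_le.1 hw).2
  linarith

/-- If the fixed point took the same value at `z` and at `rz`, `r > 1`, the averages there would be
equal, so that it would be invariant under `w ↦ rw` on `[z, ∞)`, and hence `1` at `z`. -/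
theorem limitRatio_strictMonoOn (h : IsTailKernel k m γ) :
    StrictMonoOn (limitRatio k m γ) (Ioi 0) := by
  intro z (hz : 0 < z) w (hw : 0 < w) hzw
  have hV := h.isRatio_limitRatio
  set V := limitRatio k m γ
  set r := w / z with hr
  have hr1 : 1 < r := (one_lt_div hz).2 hzw
  have hr0 : 0 < r := by linarith
  have hwr : w = z * r := by rw [hr]; field_simp
  by_contra hcon
  have hinv : ∀ t, 1 < t → V (z * t) = V (z * t * r) := by
    intro t ht
    have ht0 : 0 < t := by linarith
    by_contra hne
    have hlt : V (z * t) < V (z * t * r) := by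
      refine lt_of_le_of_ne (hV.mono (mul_pos hz ht0) (mul_pos (mul_pos hz ht0) hr0) ?_) hne
      exact le_mul_of_one_le_right (mul_pos hz ht0).le hr1.le
    have hpos : 0 < ∫ σ in Ioo (0 : ℝ) 1, k σ * (V (w / σ) - V (z / σ)) := by
      refine h.toIsDensity.integral_mul_pos (σ₀ := 1 / t)
        ((hV.continuousOn_comp_div hw).sub (hV.continuousOn_comp_div hz)) ?_ ?_
        ⟨by positivity, (div_lt_one ht0).2 ht⟩ ?_
      · intro σ hσ
        exact sub_nonneg.2 (hV.mono (div_pos hz hσ.1) (div_pos hw hσ.1)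
          (div_le_div_of_nonneg_right hzw.le hσ.1.le))
      · simp_rw [mul_sub]
        exact (h.toIsDensity.integrableOn_avg hV hw).sub (h.toIsDensity.integrableOn_avg hV hz)
      · have e1 : w / (1 / t) = z * t * r := by rw [hwr]; field_simp
        have e2 : z / (1 / t) = z * t := by field_simp
        rw [e1, e2]; linarith
    simp_rw [mul_sub] at hpos
    rw [integral_sub (h.toIsDensity.integrableOn_avg hV hw)
      (h.toIsDensity.integrableOn_avg hV hz)] at hpos
    change 0 < avg k V w - avg k V z at hpos
    rw [← h.limitRatio_rpow hw, ← h.limitRatio_rpow hz, sub_pos] at hpos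
    exact hcon ((rpow_lt_rpow_iff (hV.nonneg _ hz) (hV.nonneg _ hw) h.m_pos).1 hpos)
  have hconst : ∀ n : ℕ, V (z * r) = V (z * r * r ^ n) := by
    intro n
    induction n with
    | zero => simp
    | succ n ih =>
      have h1 : 1 < r * r ^ n := one_lt_mul_of_lt_of_le hr1 (one_le_pow₀ hr1.le)
      have := hinv (r * r ^ n) h1
      rw [ih, mul_assoc, this]
      congr 1; ring
  have hlim : Tendsto (fun n : ℕ => V (z * r * r ^ n)) atTop (𝓝 1) :=
    h.tendsto_limitRatio_atTop.comp
      ((tendsto_pow_atTop_atTop_of_one_lt hr1).const_mul_atTop (mul_pos hz hr0))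
  have h1 : V (z * r) = 1 :=
    tendsto_nhds_unique (tendsto_const_nhds.congr hconst) hlim
  exact (h.limitRatio_lt_one (mul_pos hz hr0)).ne h1

/-- The limit `l` at zero satisfies `l^m = l` and `l < 1`. -/
theorem tendsto_limitRatio_zero (h : IsTailKernel k m γ) :
    Tendsto (limitRatio k m γ) (𝓝[>] 0) (𝓝 0) := by
  have hV := h.isRatio_limitRatio
  have hbdd : BddBelow (limitRatio k m γ '' Ioi 0) := by
    refine ⟨0, ?_⟩
    rintro _ ⟨z, hz, rfl⟩
    exact hV.nonneg z hz
  have hl := hV.mono.tendsto_nhdsGT hbdd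
  set l := sInf (limitRatio k m γ '' Ioi 0)
  have hl0 : 0 ≤ l := ge_of_tendsto hl (by
    filter_upwards [self_mem_nhdsWithin] with z hz using hV.nonneg z hz)
  have hl1 : l < 1 :=
    (csInf_le hbdd ⟨1, mem_Ioi.2 one_pos, rfl⟩).trans_lt (h.limitRatio_lt_one one_pos)
  have hdiv : ∀ σ ∈ Ioo (0 : ℝ) 1, Tendsto (fun z : ℝ => z / σ) (𝓝[>] 0) (𝓝[>] 0) := by
    intro σ hσ
    refine tendsto_nhdsWithin_iff.2 ⟨?_, ?_⟩
    · have : Tendsto (fun z : ℝ => z / σ) (𝓝 0) (𝓝 (0 / σ)) := tendsto_id.div_const σ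
      rw [zero_div] at this
      exact this.mono_left nhdsWithin_le_nhds
    · filter_upwards [self_mem_nhdsWithin] with z hz using div_pos hz hσ.1
  have h1 : Tendsto (fun z => avg k (limitRatio k m γ) z) (𝓝[>] 0)
      (𝓝 (∫ σ in Ioo (0 : ℝ) 1, k σ * l)) := by
    refine h.toIsDensity.tendsto_integral_mul ?_ ?_ ?_
    · filter_upwards [self_mem_nhdsWithin] with z hz using hV.continuousOn_comp_div hz
    · filter_upwards [self_mem_nhdsWithin] with z hz σ hσ using hV.abs_le_one (div_pos hz hσ.1)
    · exact fun σ hσ => hl.comp (hdiv σ hσ)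
  rw [integral_mul_const, h.integral_eq, one_mul] at h1
  have h2 : Tendsto (fun z => limitRatio k m γ z ^ m) (𝓝[>] 0) (𝓝 (l ^ m)) :=
    hl.rpow_const (Or.inr h.m_pos.le)
  have h3 : l ^ m = l := by
    refine tendsto_nhds_unique (h2.congr' ?_) h1
    filter_upwards [self_mem_nhdsWithin] with z hz using h.limitRatio_rpow hz
  rcases hl0.eq_or_lt with h4 | h4
  · rwa [← h4] at hl
  · have := rpow_lt_rpow_of_exponent_gt h4 hl1 h.m_lt_one
    rw [rpow_one] at this
    exact absurd h3 this.ne'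

/-- A bound `λ z^a` on the iterates is propagated by averaging wherever `λ z^a` is small, and it is
trivial where `λ z^a ≥ 1`. As the fixed point is small near zero, `λ` can be chosen such that the bound
also holds in between. One more averaging improves the power from `a` to `a/m`. -/
theorem exists_limitRatio_le_rpow (h : IsTailKernel k m γ) {a : ℝ} (ha : 0 < a)
    (hi : IntegrableOn (fun σ => k σ * σ ^ (-a)) (Ioo 0 1)) :
    ∃ C, 0 ≤ C ∧ ∀ z, 0 < z → limitRatio k m γ z ≤ C * z ^ (a / m) := by
  have hV := h.isRatio_limitRatio
  have hm := h.m_pos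
  set Φ := moment k (-a) with hΦ
  have hΦ0 : 0 < Φ := h.toIsDensity.integral_mul_pos (continuousOn_rpow_Ioo _)
    (fun σ hσ => rpow_nonneg hσ.1.le _) hi (σ₀ := 1 / 2) (by norm_num) (by positivity)
  have hdiv : ∀ z, 0 < z → ∀ σ ∈ Ioo (0 : ℝ) 1, (z / σ) ^ a = σ ^ (-a) * z ^ a := by
    intro z hz σ hσ
    have := div_rpow_neg (e := -a) hz hσ.1
    rwa [neg_neg] at this
  -- one averaging step
  have havg : ∀ f : ℝ → ℝ, IsRatio f → ∀ C : ℝ, (∀ z, 0 < z → f z ≤ C * z ^ a) →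
      ∀ z, 0 < z → avg k f z ≤ C * Φ * z ^ a := by
    intro f hf C hC z hz
    have e : C * Φ * z ^ a = ∫ σ in Ioo (0 : ℝ) 1, C * z ^ a * (k σ * σ ^ (-a)) := by
      rw [integral_const_mul, hΦ, moment]; ring
    rw [e]
    refine setIntegral_mono_on (h.toIsDensity.integrableOn_avg hf hz) (hi.const_mul _)
      measurableSet_Ioo fun σ hσ => ?_
    have h1 := hC (z / σ) (div_pos hz hσ.1)
    rw [hdiv z hz σ hσ] at h1
    calc k σ * f (z / σ) ≤ k σ * (C * (σ ^ (-a) * z ^ a)) :=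
          mul_le_mul_of_nonneg_left h1 (h.pos σ hσ).le
      _ = _ := by ring
  suffices hbase : ∃ C, 0 < C ∧ ∀ z, 0 < z → limitRatio k m γ z ≤ C * z ^ a by
    obtain ⟨C, hC0, hC⟩ := hbase
    refine ⟨(C * Φ) ^ (1 / m), by positivity, fun z hz => ?_⟩
    rw [← h.ratioStep_limitRatio hz, ratioStep]
    calc _ ≤ (C * Φ * z ^ a) ^ (1 / m) :=
          rpow_le_rpow (h.toIsDensity.avg_nonneg hV hz) (havg _ hV C hC z hz) (by positivity)
      _ = _ := by
        rw [mul_rpow (by positivity) (rpow_nonneg hz.le _), ← rpow_mul hz.le, mul_one_div]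
  have hm1 : 0 < 1 - m := by linarith [h.m_lt_one]
  set δ := Φ ^ (-(1 / (1 - m))) with hδ
  have hδ0 : 0 < δ := rpow_pos_of_pos hΦ0 _
  -- the range of values in which the step propagates the bound
  have hsmall : ∀ x, 0 < x → x ≤ δ → (Φ * x) ^ (1 / m) ≤ x := by
    intro x hx hxδ
    have h1 : x ^ (1 - m) ≤ Φ⁻¹ := by
      refine (rpow_le_rpow hx.le hxδ hm1.le).trans_eq ?_
      rw [hδ, ← rpow_mul hΦ0.le, neg_mul, one_div_mul_cancel hm1.ne', rpow_neg_one]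
    have h2 : Φ * x ≤ x ^ m := by
      have e : x = x ^ (1 - m) * x ^ m := by rw [← rpow_add hx]; simp
      calc Φ * x = Φ * (x ^ (1 - m) * x ^ m) := by rw [← e]
        _ ≤ Φ * (Φ⁻¹ * x ^ m) := by gcongr
        _ = x ^ m := by field_simp
    calc _ ≤ (x ^ m) ^ (1 / m) := rpow_le_rpow (by positivity) h2 (by positivity)
      _ = x := by rw [← rpow_mul hx.le, mul_one_div_cancel hm.ne', rpow_one]
  obtain ⟨z₁, hz₁δ, hz₁⟩ := ((h.tendsto_limitRatio_zero.eventually_lt_const hδ0).and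
    (Ioo_mem_nhdsGT one_pos)).exists
  have hz₁a : 0 < z₁ ^ a := rpow_pos_of_pos hz₁.1 _
  refine ⟨(z₁ ^ a)⁻¹, inv_pos.2 hz₁a, fun z hz => ?_⟩
  have hs := fun n => (isRatio_startRatio h.exponent_pos).iterate h.toIsDensity h.m_pos n
  refine le_of_tendsto' (h.tendsto_iterate hz) fun n => ?_
  induction n generalizing z with
  | zero =>
    have h0 : startRatio γ z ≤ 1 := (isRatio_startRatio h.exponent_pos).le_one z hz
    rcases le_total z 1 with h1 | h1
    · have h2 := one_le_rpow_of_pos_of_le_one_of_nonpos hz h1 (neg_nonpos.2 h.exponent_pos.le)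
      have h3 : startRatio γ z = 0 := max_eq_right (by linarith)
      change startRatio γ z ≤ _
      rw [h3]
      positivity
    · have : z₁ ^ a ≤ z ^ a := rpow_le_rpow hz₁.1.le (hz₁.2.le.trans h1) ha.le
      exact h0.trans (by rwa [inv_mul_eq_div, one_le_div hz₁a])
  | succ n ih =>
    rcases le_total ((z₁ ^ a)⁻¹ * z ^ a) δ with h1 | h1
    · rw [Function.iterate_succ_apply', ratioStep]
      refine (rpow_le_rpow (h.toIsDensity.avg_nonneg (hs n) hz)
        (havg _ (hs n) _ (fun z hz => ih z hz) z hz) (by positivity)).trans ?_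
      refine le_of_eq_of_le ?_ (hsmall _ (by positivity) h1)
      congr 1; ring
    · rcases le_total z z₁ with h2 | h2
      · exact (((h.iterate_le_limitRatio _ hz).trans (hV.mono hz hz₁.1 h2)).trans hz₁δ.le).trans h1
      · refine ((hs _).le_one z hz).trans ?_
        rw [inv_mul_eq_div, one_le_div hz₁a]
        exact rpow_le_rpow hz₁.1.le h2 ha.le

end IsTailKernel

/-! ### Stability of the fixed point under convergence of the densities -/

section Stability

variable {ι : Type*} {l : Filter ι} [l.IsCountablyGenerated] {K : ι → ℝ → ℝ} {k : ℝ → ℝ}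
  {g : ι → ℝ} {m γ : ℝ}

theorem tendsto_moment (hK : ∀ᶠ i in l, IsDensity (K i)) (hk : IsDensity k)
    (hlim : ∀ σ ∈ Ioo (0 : ℝ) 1, Tendsto (fun i => K i σ) l (𝓝 (k σ))) {e : ℝ} (he : 0 ≤ e) :
    Tendsto (fun i => moment (K i) e) l (𝓝 (moment k e)) :=
  tendsto_integral_density_mul hK hk hlim (.of_forall fun _ => continuousOn_rpow_Ioo e)
    (.of_forall fun _ _ hσ => abs_rpow_le_one hσ he) fun _ _ => tendsto_const_nhds

theorem tendsto_tail_exponent (hK : ∀ᶠ i in l, IsTailKernel (K i) m (g i))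
    (hk : IsTailKernel k m γ)
    (hlim : ∀ σ ∈ Ioo (0 : ℝ) 1, Tendsto (fun i => K i σ) l (𝓝 (k σ))) :
    Tendsto g l (𝓝 γ) := by
  have hmom := fun {e : ℝ} (he : 0 ≤ e) =>
    tendsto_moment (hK.mono fun i hi => hi.toIsDensity) hk.toIsDensity hlim he
  refine tendsto_order.2 ⟨fun a ha => ?_, fun a ha => ?_⟩
  · rcases lt_or_ge a 0 with h0 | h0
    · filter_upwards [hK] with i hi using h0.trans hi.exponent_pos
    have h1 : m < moment k a := by
      rw [← hk.moment_eq]; exact hk.toIsDensity.moment_strictAnti h0 ha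
    filter_upwards [hK, (hmom h0).eventually_const_lt h1] with i hi h2
    by_contra! h3
    rcases h3.eq_or_lt with h4 | h4
    · rw [← h4, hi.moment_eq] at h2; exact lt_irrefl _ h2
    · have := hi.toIsDensity.moment_strictAnti hi.exponent_pos.le h4
      rw [hi.moment_eq] at this
      linarith
  · have h0 : 0 ≤ a := (hk.exponent_pos.trans ha).le
    have h1 : moment k a < m := by
      rw [← hk.moment_eq]; exact hk.toIsDensity.moment_strictAnti hk.exponent_pos.le ha
    filter_upwards [hK, (hmom h0).eventually_lt_const h1] with i hi h2
    by_contra! h3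
    rcases h3.eq_or_lt with h4 | h4
    · rw [h4, hi.moment_eq] at h2; exact lt_irrefl _ h2
    · have := hi.toIsDensity.moment_strictAnti h0 h4
      rw [hi.moment_eq] at this
      linarith

theorem tendsto_iterate_startRatio (hK : ∀ᶠ i in l, IsTailKernel (K i) m (g i))
    (hk : IsTailKernel k m γ)
    (hlim : ∀ σ ∈ Ioo (0 : ℝ) 1, Tendsto (fun i => K i σ) l (𝓝 (k σ))) (n : ℕ) {z : ℝ}
    (hz : 0 < z) :
    Tendsto (fun i => (ratioStep (K i) m)^[n] (startRatio (g i)) z) l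
      (𝓝 ((ratioStep k m)^[n] (startRatio γ) z)) := by
  induction n generalizing z with
  | zero =>
    have h1 : Tendsto (fun i => z ^ (-g i)) l (𝓝 (z ^ (-γ))) :=
      ((continuousAt_const_rpow hz.ne').tendsto).comp (tendsto_tail_exponent hK hk hlim).neg
    exact (tendsto_const_nhds.sub h1).max tendsto_const_nhds
  | succ n ih =>
    simp_rw [Function.iterate_succ_apply']
    refine Tendsto.rpow_const ?_ (Or.inr (by have := hk.m_pos; positivity))
    refine tendsto_integral_density_mul (hK.mono fun i hi => hi.toIsDensity) hk.toIsDensity hlim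
      ?_ ?_ fun σ hσ => ih (div_pos hz hσ.1)
    · filter_upwards [hK] with i hi
      exact ((isRatio_startRatio hi.exponent_pos).iterate hi.toIsDensity
        hi.m_pos n).continuousOn_comp_div hz
    · filter_upwards [hK] with i hi σ hσ
      exact ((isRatio_startRatio hi.exponent_pos).iterate hi.toIsDensity
        hi.m_pos n).abs_le_one (div_pos hz hσ.1)

/-- Each iterate converges, and the iterates converge to their limits uniformly in the parameter,
as the contraction factors stay away from one. -/
theorem tendsto_limitRatio (hK : ∀ᶠ i in l, IsTailKernel (K i) m (g i))
    (hk : IsTailKernel k m γ)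
    (hlim : ∀ σ ∈ Ioo (0 : ℝ) 1, Tendsto (fun i => K i σ) l (𝓝 (k σ))) {z : ℝ} (hz : 0 < z) :
    Tendsto (fun i => limitRatio (K i) m (g i) z) l (𝓝 (limitRatio k m γ z)) := by
  have hm := hk.m_pos
  have hγ := hk.exponent_pos
  have hg := tendsto_tail_exponent hK hk hlim
  -- a common contraction factor
  obtain ⟨θ, hθ0, hθ1, hθ⟩ : ∃ θ, 0 < θ ∧ θ < 1 ∧ ∀ᶠ i in l, moment (K i) (2 * g i) / m ≤ θ := by
    have h1 : moment k (3 / 2 * γ) / m < 1 := by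
      rw [div_lt_one hm, ← hk.moment_eq]
      exact hk.toIsDensity.moment_strictAnti hγ.le (by linarith)
    obtain ⟨θ, hθ, hθ1⟩ := exists_between h1
    have h0 : 0 < moment k (3 / 2 * γ) / m :=
      div_pos (hk.toIsDensity.moment_pos (by positivity)) hm
    refine ⟨θ, h0.trans hθ, hθ1, ?_⟩
    have h2 := (tendsto_moment (hK.mono fun i hi => hi.toIsDensity) hk.toIsDensity hlim
      (e := 3 / 2 * γ) (by positivity)).div_const m
    filter_upwards [hK, h2.eventually_lt_const hθ,
      hg.eventually_const_lt (show 3 / 4 * γ < γ by linarith)] with i hi h3 h4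
    refine le_trans (div_le_div_of_nonneg_right ?_ hm.le) h3.le
    exact (hi.toIsDensity.moment_strictAnti (by positivity) (by linarith)).le
  have hz2 : ∀ᶠ i in l, z ^ (-(2 * g i)) ≤ z ^ (-(2 * γ)) + 1 := by
    have h1 : Tendsto (fun i => z ^ (-(2 * g i))) l (𝓝 (z ^ (-(2 * γ)))) :=
      ((continuousAt_const_rpow hz.ne').tendsto).comp (hg.const_mul 2).neg
    filter_upwards [h1.eventually_lt_const (lt_add_one _)] with i hi using hi.le
  set C := z ^ (-(2 * γ)) + 1 with hC
  have hC0 : 0 < C := by have := rpow_pos_of_pos hz (-(2 * γ)); positivity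
  have herr : ∀ᶠ i in l, ∀ n : ℕ, |(ratioStep (K i) m)^[n] (startRatio (g i)) z -
      limitRatio (K i) m (g i) z| ≤ C * θ ^ n / (1 - θ) := by
    filter_upwards [hK, hθ, hz2] with i hi h1 h2 n
    refine (hi.abs_iterate_sub_limitRatio_le n hz).trans ?_
    have := hi.ratio_nonneg
    have := hi.ratio_lt_one
    have : 0 < 1 - θ := by linarith
    gcongr
  rw [Metric.tendsto_nhds]
  intro ε hε
  have hsmall : Tendsto (fun n : ℕ => C * θ ^ n / (1 - θ)) atTop (𝓝 0) := by
    simpa using ((tendsto_pow_atTop_nhds_zero_of_lt_one hθ0.le hθ1).const_mul C).div_const (1 - θ)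
  have hnear := (Metric.tendsto_nhds.1 (hk.tendsto_iterate hz)) (ε / 3) (by positivity)
  obtain ⟨n, hn1, hn2⟩ :=
    ((hsmall.eventually_lt_const (show 0 < ε / 3 by positivity)).and hnear).exists
  filter_upwards [herr, (Metric.tendsto_nhds.1 (tendsto_iterate_startRatio hK hk hlim n hz))
    (ε / 3) (by positivity)] with i h1 h2
  have h3 : dist (limitRatio (K i) m (g i) z) ((ratioStep (K i) m)^[n] (startRatio (g i)) z)
      < ε / 3 := by
    rw [dist_comm]; exact (h1 n).trans_lt hn1
  calc _ ≤ _ := dist_triangle4 _ _ _ _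
    _ < ε / 3 + ε / 3 + ε / 3 := by gcongr
    _ = ε := by ring

end Stability

/-! ### The classical kernel and the Barenblatt profile -/

/-- The density `q σ^{q-1}`, `q = 2m/(1-m)`: the limit of the densities as `α → 1`. -/
noncomputable def classicalKernel (m σ : ℝ) : ℝ :=
  2 * m / (1 - m) * σ ^ (2 * m / (1 - m) - 1)

/-- The Barenblatt profile divided by the very singular solution. -/
noncomputable def barenblattRatio (m z : ℝ) : ℝ := (1 + (1 - m) * z ^ (-2 : ℝ)) ^ (-1 / (1 - m))

section Classical

variable {m : ℝ}

theorem integrableOn_mul_rpow_sub_one {q : ℝ} (hq : 0 < q) :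
    IntegrableOn (fun σ : ℝ => q * σ ^ (q - 1)) (Ioo 0 1) := by
  have := (intervalIntegral.intervalIntegrable_rpow' (a := 0) (b := 1)
    (r := q - 1) (by linarith)).const_mul q
  rwa [intervalIntegrable_iff_integrableOn_Ioo_of_le zero_le_one] at this

theorem integral_mul_rpow_sub_one (q : ℝ) {r : ℝ} (hr : 0 < r) :
    ∫ σ in Ioo (0 : ℝ) 1, q * σ ^ (r - 1) = q / r := by
  rw [← integral_Ioc_eq_integral_Ioo, ← intervalIntegral.integral_of_le zero_le_one,
    intervalIntegral.integral_const_mul, integral_rpow (Or.inl (by linarith))]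
  simp [hr.ne', div_eq_mul_inv]

theorem isTailKernel_classicalKernel (hm : 0 < m) (hm1 : m < 1) :
    IsTailKernel (classicalKernel m) m 2 := by
  have h1 : 0 < 1 - m := by linarith
  have hq : 0 < 2 * m / (1 - m) := by positivity
  refine ⟨⟨fun σ hσ => mul_pos hq (rpow_pos_of_pos hσ.1 _), integrableOn_mul_rpow_sub_one hq, ?_⟩,
    hm, hm1, two_pos, ?_⟩
  · unfold classicalKernel
    rw [integral_mul_rpow_sub_one _ hq, div_self hq.ne']
  · have : moment (classicalKernel m) 2 = ∫ σ in Ioo (0 : ℝ) 1,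
        2 * m / (1 - m) * σ ^ ((2 * m / (1 - m) + 2) - 1) := by
      refine setIntegral_congr_fun measurableSet_Ioo fun σ hσ => ?_
      simp only [classicalKernel]
      rw [mul_assoc, ← rpow_add hσ.1]
      congr 2; ring
    rw [this, integral_mul_rpow_sub_one _ (by positivity)]
    field_simp
    ring

theorem barenblattRatio_pos (hm1 : m < 1) {z : ℝ} (hz : 0 < z) : 0 < barenblattRatio m z := by
  have h1 : 0 < 1 - m := by linarith
  have := rpow_pos_of_pos hz (-2)
  exact rpow_pos_of_pos (by positivity) _

theorem barenblattRatio_le (hm : 0 < m) (hm1 : m < 1) {z : ℝ} (hz : 0 < z) :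
    barenblattRatio m z ≤ (1 + z ^ (-2 : ℝ))⁻¹ := by
  have h1 : 0 < 1 - m := by linarith
  have hy := rpow_pos_of_pos hz (-2)
  rw [barenblattRatio, neg_div, rpow_neg (by positivity)]
  refine inv_anti₀ (by positivity) ?_
  have := one_add_mul_self_le_rpow_one_add (s := (1 - m) * z ^ (-2 : ℝ)) (by
    have : 0 < (1 - m) * z ^ (-2 : ℝ) := by positivity
    linarith) (p := 1 / (1 - m)) ((one_le_div h1).2 (by linarith))
  rwa [← mul_assoc, one_div_mul_cancel h1.ne', one_mul] at this

theorem le_barenblattRatio (hm : 0 < m) (hm1 : m < 1) {z : ℝ} (hz : 0 < z) :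
    1 - z ^ (-2 : ℝ) ≤ barenblattRatio m z := by
  have h1 : 0 < 1 - m := by linarith
  have hy := rpow_pos_of_pos hz (-2)
  have hx : 0 < 1 + (1 - m) * z ^ (-2 : ℝ) := by positivity
  rw [barenblattRatio, neg_div, rpow_neg hx.le, ← inv_rpow hx.le]
  have h2 := one_add_mul_self_le_rpow_one_add (s := (1 + (1 - m) * z ^ (-2 : ℝ))⁻¹ - 1)
    (by linarith [inv_pos.2 hx]) (p := 1 / (1 - m)) ((one_le_div h1).2 (by linarith))
  rw [add_sub_cancel] at h2
  refine le_trans ?_ h2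
  have h3 : 1 - (1 - m) * z ^ (-2 : ℝ) ≤ (1 + (1 - m) * z ^ (-2 : ℝ))⁻¹ := by
    rw [← one_div, le_div_iff₀ hx]
    nlinarith [sq_nonneg ((1 - m) * z ^ (-2 : ℝ))]
  have h4 : 1 / (1 - m) * (-((1 - m) * z ^ (-2 : ℝ))) ≤
      1 / (1 - m) * ((1 + (1 - m) * z ^ (-2 : ℝ))⁻¹ - 1) :=
    mul_le_mul_of_nonneg_left (by linarith) (by positivity)
  rw [mul_neg, ← mul_assoc, one_div_mul_cancel h1.ne', one_mul] at h4
  linarith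

theorem isRatio_barenblattRatio (hm : 0 < m) (hm1 : m < 1) : IsRatio (barenblattRatio m) where
  cont := by
    have h1 : 0 < 1 - m := by linarith
    intro z hz
    have hy := rpow_pos_of_pos hz (-2)
    refine ContinuousAt.continuousWithinAt ?_
    refine ContinuousAt.rpow_const (continuousAt_const.add (continuousAt_const.mul
      (continuousAt_rpow_const _ _ (Or.inl (ne_of_gt hz))))) (Or.inl ?_)
    positivity
  mono z hz w hw hzw := by
    have h1 : 0 < 1 - m := by linarith
    have hw := rpow_pos_of_pos hw (-2)
    refine rpow_le_rpow_of_nonpos (by positivity) ?_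
      (div_nonpos_of_nonpos_of_nonneg (by norm_num) h1.le)
    have := rpow_le_rpow_of_nonpos hz hzw (show (-2 : ℝ) ≤ 0 by norm_num)
    gcongr
  nonneg z hz := (barenblattRatio_pos hm1 hz).le
  le_one z hz := (barenblattRatio_le hm hm1 hz).trans
    (inv_le_one_of_one_le₀ (by linarith [rpow_pos_of_pos hz (-2)]))

/-- The integrand is the derivative of `σ^q (1 + cσ²)^{-m/(1-m)}` with `c = (1-m) z^{-2}`. -/
theorem avg_classicalKernel_barenblattRatio (hm : 0 < m) (hm1 : m < 1) {z : ℝ} (hz : 0 < z) :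
    avg (classicalKernel m) (barenblattRatio m) z = barenblattRatio m z ^ m := by
  have h1 : 0 < 1 - m := by linarith
  have hq : 0 < 2 * m / (1 - m) := by positivity
  set c := (1 - m) * z ^ (-2 : ℝ) with hc
  have hc0 : 0 < c := by have := rpow_pos_of_pos hz (-2); positivity
  set q := 2 * m / (1 - m) with hqd
  set F : ℝ → ℝ := fun σ => σ ^ q * (1 + c * σ ^ 2) ^ (-m / (1 - m)) with hF
  have hpos : ∀ σ : ℝ, 0 < 1 + c * σ ^ 2 := fun σ => by positivity
  have hcont : ContinuousOn F (Icc 0 1) := by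
    refine ContinuousOn.mul (fun σ _ =>
      (continuousAt_rpow_const _ _ (Or.inr hq.le)).continuousWithinAt) ?_
    refine ContinuousOn.rpow_const (by fun_prop) fun σ _ => Or.inl (hpos σ).ne'
  have hval : ∀ σ ∈ Ioo (0 : ℝ) 1, classicalKernel m σ * barenblattRatio m (z / σ) =
      q * σ ^ (q - 1) * (1 + c * σ ^ 2) ^ (-1 / (1 - m)) := by
    intro σ hσ
    rw [classicalKernel, barenblattRatio, div_rpow_neg hz hσ.1]
    have : σ ^ (2 : ℝ) = σ ^ 2 := rpow_two σ
    rw [this]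
    congr 2
    rw [hc]; ring
  have hderiv : ∀ σ ∈ Ioo (0 : ℝ) 1,
      HasDerivAt F (classicalKernel m σ * barenblattRatio m (z / σ)) σ := by
    intro σ hσ
    rw [hval σ hσ]
    have d1 := hasDerivAt_rpow_const (x := σ) (p := q) (Or.inl hσ.1.ne')
    have d2 : HasDerivAt (fun σ : ℝ => 1 + c * σ ^ 2) (c * (2 * σ)) σ := by
      simpa using ((hasDerivAt_pow 2 σ).const_mul c).const_add 1
    have d3 := d2.rpow_const (p := -m / (1 - m)) (Or.inl (hpos σ).ne')
    refine (d1.mul d3).congr_deriv ?_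
    have e1 : -m / (1 - m) - 1 = -1 / (1 - m) := by field_simp; ring
    have e2 : (1 + c * σ ^ 2) ^ (-m / (1 - m)) =
        (1 + c * σ ^ 2) * (1 + c * σ ^ 2) ^ (-1 / (1 - m)) := by
      rw [← e1, rpow_sub_one (hpos σ).ne']
      field_simp [(hpos σ).ne']
    have e3 : σ ^ q = σ * σ ^ (q - 1) := by
      rw [rpow_sub_one hσ.1.ne']; field_simp [hσ.1.ne']
    rw [e1, e2, e3, hqd]
    field_simp
    ring
  have hint := (isTailKernel_classicalKernel hm hm1).toIsDensity.integrableOn_avg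
    (isRatio_barenblattRatio hm hm1) hz
  rw [avg, ← integral_Ioc_eq_integral_Ioo, ← intervalIntegral.integral_of_le zero_le_one,
    intervalIntegral.integral_eq_sub_of_hasDerivAt_of_le zero_le_one hcont hderiv
    ((intervalIntegrable_iff_integrableOn_Ioo_of_le zero_le_one).2 hint)]
  simp only [hF, zero_rpow hq.ne', one_rpow, zero_mul, sub_zero, one_mul, one_pow, mul_one]
  rw [barenblattRatio, ← rpow_mul (by positivity)]
  congr 1; ring

theorem limitRatio_classicalKernel (hm : 0 < m) (hm1 : m < 1) {z : ℝ} (hz : 0 < z) :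
    limitRatio (classicalKernel m) m 2 z = barenblattRatio m z := by
  have hk := isTailKernel_classicalKernel hm hm1
  have hB := isRatio_barenblattRatio hm hm1
  refine hk.eq_limitRatio hB (fun z hz => ?_) (C := 1) (fun z hz => ?_) hz
  · rw [ratioStep, avg_classicalKernel_barenblattRatio hm hm1 hz,
      ← rpow_mul (hB.nonneg z hz), mul_one_div_cancel hm.ne', rpow_one]
  · rw [one_mul]
    refine (isRatio_startRatio two_pos).abs_sub_le_of_one_le hB two_pos (fun z hz => ?_) hz
    have hz0 : 0 < z := by linarith
    rw [startRatio_of_one_le two_pos hz, rpow_neg_two_mul hz0]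
    have h1 := le_barenblattRatio hm hm1 hz0
    have h2 := (barenblattRatio_le hm hm1 hz0).trans (one_add_inv_le (rpow_pos_of_pos hz0 _).le)
    rw [abs_le]
    constructor <;> nlinarith

end Classical

/-! ### The Beta integral and moments of tail integrals -/

theorem integrableOn_beta {u v : ℝ} (hu : 0 < u) (hv : 0 < v) :
    IntegrableOn (fun x : ℝ => x ^ (u - 1) * (1 - x) ^ (v - 1)) (Ioo 0 1) ∧
      ∫ x in Ioo (0 : ℝ) 1, x ^ (u - 1) * (1 - x) ^ (v - 1) =
        Gamma u * Gamma v / Gamma (u + v) := by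
  have hB : 0 < ProbabilityTheory.beta u v := ProbabilityTheory.beta_pos hu hv
  set f : ℝ → ℝ := fun x => 1 / ProbabilityTheory.beta u v * x ^ (u - 1) * (1 - x) ^ (v - 1)
  have hf : Measurable f := by fun_prop
  have h1 : ∫⁻ x in Ioo (0 : ℝ) 1, ENNReal.ofReal (f x) = 1 := by
    rw [← ProbabilityTheory.lintegral_betaPDF, ProbabilityTheory.lintegral_betaPDF_eq_one hu hv]
  have hf0 : 0 ≤ᵐ[volume.restrict (Ioo (0 : ℝ) 1)] f := by
    filter_upwards [ae_restrict_mem measurableSet_Ioo] with x hx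
    have := hx.1
    have : 0 ≤ 1 - x := by linarith [hx.2]
    change 0 ≤ 1 / ProbabilityTheory.beta u v * x ^ (u - 1) * (1 - x) ^ (v - 1)
    positivity
  have hi : IntegrableOn f (Ioo 0 1) :=
    (lintegral_ofReal_ne_top_iff_integrable hf.aestronglyMeasurable hf0).1 (by rw [h1]; simp)
  have hI : ∫ x in Ioo (0 : ℝ) 1, f x = 1 := by
    rw [integral_eq_lintegral_of_nonneg_ae hf0 hf.aestronglyMeasurable, h1]; simp
  have e : ∀ x : ℝ, x ^ (u - 1) * (1 - x) ^ (v - 1) = ProbabilityTheory.beta u v * f x := by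
    intro x
    change _ = ProbabilityTheory.beta u v *
      (1 / ProbabilityTheory.beta u v * x ^ (u - 1) * (1 - x) ^ (v - 1))
    field_simp
  simp_rw [e]
  refine ⟨hi.const_mul _, ?_⟩
  rw [integral_const_mul, hI, mul_one]
  rfl

theorem image_rpow_Ioo {b : ℝ} (hb : 0 < b) :
    (fun x : ℝ => x ^ b) '' Ioo 0 1 = Ioo 0 1 := by
  ext s
  constructor
  · rintro ⟨x, hx, rfl⟩
    exact ⟨rpow_pos_of_pos hx.1 _, rpow_lt_one hx.1.le hx.2 hb⟩
  · intro hs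
    refine ⟨s ^ (1 / b), ⟨rpow_pos_of_pos hs.1 _, rpow_lt_one hs.1.le hs.2 (by positivity)⟩, ?_⟩
    simp only
    rw [← rpow_mul hs.1.le, one_div_mul_cancel hb.ne', rpow_one]

/-- The substitution `s = x^b` reduces this to the Beta integral. -/
theorem integrableOn_weight_mul_rpow {b α c : ℝ} (hb : 0 < b) (hα : α < 1) (hc : 0 < c) :
    IntegrableOn (fun s : ℝ => (1 - s ^ (1 / b)) ^ (-α) * s ^ (c - 1)) (Ioo 0 1) ∧
      ∫ s in Ioo (0 : ℝ) 1, (1 - s ^ (1 / b)) ^ (-α) * s ^ (c - 1) =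
        b * (Gamma (1 - α) * (Gamma (b * c) / Gamma (1 - α + b * c))) := by
  have hderiv : ∀ x ∈ Ioo (0 : ℝ) 1,
      HasDerivWithinAt (fun x : ℝ => x ^ b) (b * x ^ (b - 1)) (Ioo 0 1) x := fun x hx =>
    (hasDerivAt_rpow_const (Or.inl hx.1.ne')).hasDerivWithinAt
  have hinj : InjOn (fun x : ℝ => x ^ b) (Ioo 0 1) := by
    intro x hx y hy hxy
    exact (rpow_left_inj hx.1.le hy.1.le hb.ne').1 hxy
  have hbeta := integrableOn_beta (mul_pos hb hc) (show 0 < 1 - α by linarith)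
  have heq : ∀ x ∈ Ioo (0 : ℝ) 1,
      |b * x ^ (b - 1)| • ((1 - (x ^ b) ^ (1 / b)) ^ (-α) * (x ^ b) ^ (c - 1)) =
        b * (x ^ (b * c - 1) * (1 - x) ^ (1 - α - 1)) := by
    intro x hx
    rw [abs_of_nonneg (mul_nonneg hb.le (rpow_nonneg hx.1.le _)), ← rpow_mul hx.1.le,
      mul_one_div_cancel hb.ne', rpow_one, ← rpow_mul hx.1.le, smul_eq_mul]
    have e1 : x ^ (b * c - 1) = x ^ (b - 1) * x ^ (b * (c - 1)) := by
      rw [← rpow_add hx.1]; congr 1; ring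
    rw [e1, show 1 - α - 1 = -α by ring]
    ring
  constructor
  · rw [← image_rpow_Ioo hb, integrableOn_image_iff_integrableOn_abs_deriv_smul measurableSet_Ioo
      hderiv hinj, integrableOn_congr_fun heq measurableSet_Ioo]
    exact hbeta.1.const_mul b
  · rw [← image_rpow_Ioo hb, integral_image_eq_integral_abs_deriv_smul measurableSet_Ioo
      hderiv hinj, setIntegral_congr_fun measurableSet_Ioo heq, integral_const_mul, hbeta.2]
    rw [add_comm (1 - α)]
    ring

/-- Fubini's theorem on the triangle `0 < σ < s < 1`. -/
theorem integrableOn_tail_mul_rpow {h : ℝ → ℝ} (hm : Measurable h)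
    (h0 : ∀ s ∈ Ioo (0 : ℝ) 1, 0 ≤ h s) {e : ℝ} (he : 0 < e)
    (hi : IntegrableOn (fun s => h s * s ^ e) (Ioo 0 1)) :
    IntegrableOn (fun σ => (∫ s in σ..1, h s) * σ ^ (e - 1)) (Ioo 0 1) ∧
      ∫ σ in Ioo (0 : ℝ) 1, (∫ s in σ..1, h s) * σ ^ (e - 1) =
        (∫ s in Ioo (0 : ℝ) 1, h s * s ^ e) / e := by
  set μ : Measure ℝ := volume.restrict (Ioo (0 : ℝ) 1) with hμ
  set f : ℝ × ℝ → ℝ := fun x => if x.2 < x.1 then h x.1 * x.2 ^ (e - 1) else 0 with hf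
  have hfm : Measurable f :=
    Measurable.ite (measurableSet_lt measurable_snd measurable_fst) (by fun_prop) measurable_const
  have hpow : ∀ s ∈ Ioo (0 : ℝ) 1, IntegrableOn (fun σ : ℝ => σ ^ (e - 1)) (Ioo 0 s) ∧
      ∫ σ in Ioo 0 s, σ ^ (e - 1) = s ^ e / e := by
    intro s hs
    constructor
    · have := intervalIntegral.intervalIntegrable_rpow' (a := 0) (b := s)
        (r := e - 1) (by linarith)
      rwa [intervalIntegrable_iff_integrableOn_Ioo_of_le hs.1.le] at this
    · rw [← integral_Ioc_eq_integral_Ioo, ← intervalIntegral.integral_of_le hs.1.le,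
        integral_rpow (Or.inl (by linarith))]
      simp [he.ne']
  have hsec : ∀ s, (fun σ => f (s, σ)) = (Iio s).indicator fun σ => h s * σ ^ (e - 1) := by
    intro s; ext σ; simp [hf, indicator]
  have hset : ∀ s ∈ Ioo (0 : ℝ) 1, Ioo (0 : ℝ) 1 ∩ Iio s = Ioo 0 s := by
    intro s hs; ext σ; simp only [mem_inter_iff, mem_Ioo, mem_Iio]
    exact ⟨fun h => ⟨h.1.1, h.2⟩, fun h => ⟨⟨h.1, h.2.trans hs.2⟩, h.2⟩⟩
  have hsecI : ∀ s ∈ Ioo (0 : ℝ) 1, Integrable (fun σ => f (s, σ)) μ ∧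
      ∫ σ, f (s, σ) ∂μ = h s * s ^ e / e := by
    intro s hs
    constructor
    · rw [hsec, integrable_indicator_iff measurableSet_Iio, IntegrableOn, hμ,
        Measure.restrict_restrict measurableSet_Iio, inter_comm, hset s hs]
      exact (hpow s hs).1.const_mul _
    · rw [hsec, hμ, setIntegral_indicator measurableSet_Iio, hset s hs, integral_const_mul,
        (hpow s hs).2, mul_div_assoc]
  have hnorm : ∀ s ∈ Ioo (0 : ℝ) 1, ∫ σ, ‖f (s, σ)‖ ∂μ = h s * s ^ e / e := by
    intro s hs
    rw [← (hsecI s hs).2]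
    refine setIntegral_congr_fun measurableSet_Ioo fun σ hσ => ?_
    rw [Real.norm_of_nonneg]
    simp only [hf]
    split_ifs
    · exact mul_nonneg (h0 s hs) (rpow_nonneg hσ.1.le _)
    · exact le_rfl
  have hfi : Integrable f (μ.prod μ) := by
    rw [integrable_prod_iff hfm.aestronglyMeasurable]
    constructor
    · filter_upwards [ae_restrict_mem measurableSet_Ioo] with s hs using (hsecI s hs).1
    · exact (integrableOn_congr_fun hnorm measurableSet_Ioo).2 (hi.div_const e)
  have htail : ∀ σ ∈ Ioo (0 : ℝ) 1, ∫ s, f (s, σ) ∂μ = (∫ s in σ..1, h s) * σ ^ (e - 1) := by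
    intro σ hσ
    have e1 : (fun s => f (s, σ)) = (Ioi σ).indicator fun s => h s * σ ^ (e - 1) := by
      ext s; simp [hf, indicator]
    have e2 : Ioo (0 : ℝ) 1 ∩ Ioi σ = Ioo σ 1 := by
      ext s; simp only [mem_inter_iff, mem_Ioo, mem_Ioi]
      exact ⟨fun h => ⟨h.2, h.1.2⟩, fun h => ⟨⟨hσ.1.trans h.1, h.2⟩, h.1⟩⟩
    rw [e1, hμ, setIntegral_indicator measurableSet_Ioi, e2, integral_mul_const,
      intervalIntegral.integral_of_le hσ.2.le, integral_Ioc_eq_integral_Ioo]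
  constructor
  · exact (integrableOn_congr_fun htail measurableSet_Ioo).1 hfi.integral_prod_right
  · rw [← setIntegral_congr_fun measurableSet_Ioo htail, 
      ← integral_integral_swap (f := fun s σ => f (s, σ)) hfi, ← integral_div]
    exact setIntegral_congr_fun measurableSet_Ioo fun s hs => (hsecI s hs).2

/-! ### The kernel `Q` -/

/-- The integrand in the definition of `Q`. -/
noncomputable def weight (d : ℕ) (α m s : ℝ) : ℝ :=
  (1 - s ^ (1 / bExp d α m)) ^ (-α) * s ^ (1 - (d : ℝ))

theorem Q_eq (d : ℕ) (α m η : ℝ) :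
    Q d α m η = 1 / Gamma (1 - α) * ∫ s in η..1, weight d α m s := rfl

/-- The range of parameters `m_c < m < 1`, `0 < α < 1`. For `d ≥ 1` the condition `m_c < m` amounts to
`0 < m` and `d (1 - m) < 2`. -/
structure FastRange (d : ℕ) (α m : ℝ) : Prop where
  m_pos : 0 < m
  m_lt_one : m < 1
  dim : (d : ℝ) * (1 - m) < 2
  α_pos : 0 < α
  α_lt_one : α < 1

theorem weight_pos {d : ℕ} {α m : ℝ} (hb : 0 < bExp d α m) {s : ℝ} (hs : s ∈ Ioo (0 : ℝ) 1) :
    0 < weight d α m s := by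
  have : s ^ (1 / bExp d α m) < 1 := rpow_lt_one hs.1.le hs.2 (by positivity)
  exact mul_pos (rpow_pos_of_pos (by linarith) _) (rpow_pos_of_pos hs.1 _)

theorem measurable_weight (d : ℕ) (α m : ℝ) : Measurable (weight d α m) := by
  unfold weight; fun_prop

namespace FastRange

variable {d : ℕ} {α m : ℝ}

theorem bExp_pos (h : FastRange d α m) : 0 < bExp d α m :=
  div_pos h.α_pos (by nlinarith [h.dim])

theorem one_sub_pos (h : FastRange d α m) : 0 < 1 - m := by linarith [h.m_lt_one]

theorem Gamma_pos (h : FastRange d α m) : 0 < Gamma (1 - α) :=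
  Gamma_pos_of_pos (by linarith [h.α_lt_one])

theorem two_lt (h : FastRange d α m) : 2 < 2 / (1 - m) := by
  rw [lt_div_iff₀ h.one_sub_pos]; linarith [h.m_pos]

theorem dim_lt (h : FastRange d α m) : (d : ℝ) < 2 / (1 - m) := by
  rw [lt_div_iff₀ h.one_sub_pos]; exact h.dim

theorem integrableOn_weight_mul (h : FastRange d α m) {γ : ℝ} (hγ : (d : ℝ) < γ) :
    IntegrableOn (fun s => weight d α m s * s ^ (γ - 2)) (Ioo 0 1) ∧
      ∫ s in Ioo (0 : ℝ) 1, weight d α m s * s ^ (γ - 2) = bExp d α m * (Gamma (1 - α) *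
        (Gamma (bExp d α m * (γ - d)) / Gamma (1 - α + bExp d α m * (γ - d)))) := by
  have h1 := integrableOn_weight_mul_rpow h.bExp_pos h.α_lt_one (sub_pos.2 hγ)
  have e : ∀ s ∈ Ioo (0 : ℝ) 1, weight d α m s * s ^ (γ - 2) =
      (1 - s ^ (1 / bExp d α m)) ^ (-α) * s ^ (γ - d - 1) := by
    intro s hs
    rw [weight, mul_assoc, ← rpow_add hs.1]
    congr 2; ring
  rw [integrableOn_congr_fun e measurableSet_Ioo, setIntegral_congr_fun measurableSet_Ioo e]
  exact h1

theorem intervalIntegrable_weight (h : FastRange d α m) {η : ℝ} (hη : 0 < η) (hη1 : η ≤ 1) :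
    IntervalIntegrable (weight d α m) volume η 1 := by
  have h1 : IntervalIntegrable (fun s => weight d α m s * s ^ ((d : ℝ) + 1 - 2)) volume η 1 := by
    rw [intervalIntegrable_iff_integrableOn_Ioo_of_le hη1]
    exact (h.integrableOn_weight_mul (lt_add_one _)).1.mono_set (Ioo_subset_Ioo_left hη.le)
  have h2 : IntervalIntegrable
      (fun s => weight d α m s * s ^ ((d : ℝ) + 1 - 2) * s ^ (-((d : ℝ) + 1 - 2))) volume η 1 := by
    refine h1.mul_continuousOn fun s hs => ?_
    rw [uIcc_of_le hη1] at hs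
    exact (continuousAt_rpow_const _ _ (Or.inl (hη.trans_le hs.1).ne')).continuousWithinAt
  refine h2.congr fun s hs => ?_
  rw [uIoc_of_le hη1] at hs
  have := rpow_pos_of_pos (hη.trans hs.1) ((d : ℝ) + 1 - 2)
  rw [rpow_neg (hη.trans hs.1).le, mul_assoc, mul_inv_cancel₀ this.ne', mul_one]

theorem Q_pos (h : FastRange d α m) {η : ℝ} (hη : η ∈ Ioo (0 : ℝ) 1) : 0 < Q d α m η := by
  rw [Q_eq]
  refine mul_pos (one_div_pos.2 h.Gamma_pos) ?_
  refine intervalIntegral.intervalIntegral_pos_of_pos_on (h.intervalIntegrable_weight hη.1 hη.2.le)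
    (fun s hs => weight_pos h.bExp_pos ⟨hη.1.trans hs.1, hs.2⟩) hη.2

theorem Q_antitoneOn (h : FastRange d α m) : AntitoneOn (Q d α m) (Ioo 0 1) := by
  intro η hη η' hη' hle
  rw [Q_eq, Q_eq]
  refine mul_le_mul_of_nonneg_left ?_ (one_div_pos.2 h.Gamma_pos).le
  rw [intervalIntegral.integral_of_le hη.2.le, intervalIntegral.integral_of_le hη'.2.le,
    integral_Ioc_eq_integral_Ioo, integral_Ioc_eq_integral_Ioo]
  have hi := h.intervalIntegrable_weight hη.1 hη.2.le
  rw [intervalIntegrable_iff_integrableOn_Ioo_of_le hη.2.le] at hi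
  refine setIntegral_mono_set hi ?_ (Ioo_subset_Ioo_left hle).eventuallyLE
  filter_upwards [ae_restrict_mem measurableSet_Ioo] with s hs
  exact (weight_pos h.bExp_pos ⟨hη.1.trans hs.1, hs.2⟩).le

theorem integrableOn_Q_mul (h : FastRange d α m) {γ : ℝ} (hγ : (d : ℝ) < γ) (hγ2 : 2 < γ) :
    IntegrableOn (fun σ => Q d α m σ * σ ^ (γ - 3)) (Ioo 0 1) ∧
      ∫ σ in Ioo (0 : ℝ) 1, Q d α m σ * σ ^ (γ - 3) = bExp d α m / (γ - 2) *
        (Gamma (bExp d α m * (γ - d)) / Gamma (1 - α + bExp d α m * (γ - d))) := by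
  have h1 := integrableOn_tail_mul_rpow (measurable_weight d α m)
    (fun s hs => (weight_pos h.bExp_pos hs).le) (sub_pos.2 hγ2)
    (h.integrableOn_weight_mul hγ).1
  rw [(h.integrableOn_weight_mul hγ).2] at h1
  have e : ∀ σ, Q d α m σ * σ ^ (γ - 3) =
      1 / Gamma (1 - α) * ((∫ s in σ..1, weight d α m s) * σ ^ (γ - 2 - 1)) := by
    intro σ; rw [Q_eq, mul_assoc, show γ - 2 - 1 = γ - 3 by ring]
  simp_rw [e]
  refine ⟨h1.1.const_mul _, ?_⟩
  rw [integral_const_mul, h1.2]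
  have := h.Gamma_pos.ne'
  field_simp

theorem Qmoment_eq_setIntegral (γ : ℝ) :
    Qmoment d α m γ = ∫ σ in Ioo (0 : ℝ) 1, Q d α m σ * σ ^ (γ - 3) := by
  rw [Qmoment, intervalIntegral.integral_of_le zero_le_one, integral_Ioc_eq_integral_Ioo]

theorem Qmoment_two_div (h : FastRange d α m) :
    Qmoment d α m (2 / (1 - m)) = (1 - m) * bExp d α m / (2 * m) *
      (Gamma (α / (1 - m)) / Gamma (1 - α + α / (1 - m))) := by
  rw [Qmoment_eq_setIntegral, (h.integrableOn_Q_mul h.dim_lt h.two_lt).2]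
  have h1 := h.one_sub_pos
  have h2 := h.m_pos
  have h3 : 0 < 2 + (d : ℝ) * (m - 1) := by nlinarith [h.dim]
  have e1 : bExp d α m * (2 / (1 - m) - d) = α / (1 - m) := by
    rw [bExp]; field_simp; ring
  have e2 : 2 / (1 - m) - 2 = 2 * m / (1 - m) := by field_simp; ring
  rw [e1, e2]
  congr 1
  field_simp

theorem Qmoment_two_div_pos (h : FastRange d α m) : 0 < Qmoment d α m (2 / (1 - m)) := by
  rw [h.Qmoment_two_div]
  have h1 := h.one_sub_pos
  have h2 := h.m_pos
  have h3 := h.bExp_pos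
  have h4 := Gamma_pos_of_pos (div_pos h.α_pos h1)
  have h5 := Gamma_pos_of_pos (add_pos (sub_pos.2 h.α_lt_one) (div_pos h.α_pos h1))
  positivity

theorem cStar_eq (h : FastRange d α m) :
    cStar d α m = Qmoment d α m (2 / (1 - m)) ^ (-1 / (1 - m)) := by
  rw [cStar, h.Qmoment_two_div]

theorem cStar_pos (h : FastRange d α m) : 0 < cStar d α m := by
  rw [h.cStar_eq]; exact rpow_pos_of_pos h.Qmoment_two_div_pos _

theorem vss_pos (h : FastRange d α m) {z : ℝ} (hz : 0 < z) : 0 < vss d α m z :=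
  mul_pos h.cStar_pos (rpow_pos_of_pos hz _)

end FastRange

/-! ### Division by the very singular solution -/

/-- The density on `(0, 1)` proportional to `Q(σ) σ^{p-3}`, `p = 2/(1-m)`. -/
noncomputable def ratioKernel (d : ℕ) (α m σ : ℝ) : ℝ :=
  Q d α m σ * σ ^ (2 / (1 - m) - 3) / Qmoment d α m (2 / (1 - m))

namespace FastRange

variable {d : ℕ} {α m : ℝ}

theorem isDensity_ratioKernel (h : FastRange d α m) : IsDensity (ratioKernel d α m) where
  pos σ hσ := div_pos (mul_pos (h.Q_pos hσ) (rpow_pos_of_pos hσ.1 _)) h.Qmoment_two_div_pos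
  integrable := (h.integrableOn_Q_mul h.dim_lt h.two_lt).1.div_const _
  integral_eq := by
    unfold ratioKernel
    rw [integral_div, ← Qmoment_eq_setIntegral, div_self h.Qmoment_two_div_pos.ne']

theorem ratioKernel_mul_rpow {σ : ℝ} (hσ : 0 < σ) (γ : ℝ) :
    ratioKernel d α m σ * σ ^ γ =
      Q d α m σ * σ ^ (2 / (1 - m) + γ - 3) / Qmoment d α m (2 / (1 - m)) := by
  rw [ratioKernel, div_mul_eq_mul_div, mul_assoc, ← rpow_add hσ]
  congr 3; ring

theorem moment_ratioKernel (γ : ℝ) : moment (ratioKernel d α m) γ =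
    Qmoment d α m (2 / (1 - m) + γ) / Qmoment d α m (2 / (1 - m)) := by
  rw [moment, setIntegral_congr_fun measurableSet_Ioo fun σ hσ => ratioKernel_mul_rpow hσ.1 γ,
    integral_div, ← Qmoment_eq_setIntegral]

theorem tailExponentEq_iff (h : FastRange d α m) (γ : ℝ) :
    TailExponentEq d α m γ ↔ moment (ratioKernel d α m) γ = m := by
  rw [TailExponentEq, moment_ratioKernel, div_eq_iff h.Qmoment_two_div_pos.ne']

theorem gammaStar_spec (h : FastRange d α m) :
    (0 < gammaStar d α m ∧ TailExponentEq d α m (gammaStar d α m)) ∧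
      ∀ γ, 0 < γ → TailExponentEq d α m γ → γ = gammaStar d α m := by
  obtain ⟨γ, hγ, hγm, huniq⟩ := h.isDensity_ratioKernel.existsUnique_moment_eq h.m_pos h.m_lt_one
  have hset : {γ | 0 < γ ∧ TailExponentEq d α m γ} = {γ} := by
    ext γ'
    simp only [mem_ofPred_eq, mem_singleton_iff, h.tailExponentEq_iff]
    exact ⟨fun h' => huniq γ' h'.1 h'.2, fun h' => h' ▸ ⟨hγ, hγm⟩⟩
  have hg : gammaStar d α m = γ := by rw [gammaStar, hset, csInf_singleton]
  rw [hg]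
  simp only [h.tailExponentEq_iff]
  exact ⟨⟨hγ, hγm⟩, huniq⟩

theorem isTailKernel (h : FastRange d α m) :
    IsTailKernel (ratioKernel d α m) m (gammaStar d α m) :=
  ⟨h.isDensity_ratioKernel, h.m_pos, h.m_lt_one, h.gammaStar_spec.1.1,
    (h.tailExponentEq_iff _).1 h.gammaStar_spec.1.2⟩

theorem vss_rpow (h : FastRange d α m) {z : ℝ} (hz : 0 < z) :
    vss d α m z ^ m = Qmoment d α m (2 / (1 - m)) * cStar d α m * z ^ (2 - 2 / (1 - m)) := by
  have h1 := h.one_sub_pos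
  rw [vss, mul_rpow h.cStar_pos.le (rpow_nonneg hz.le _), ← rpow_mul hz.le, h.cStar_eq,
    ← rpow_mul h.Qmoment_two_div_pos.le]
  congr 1
  · have e : -1 / (1 - m) * m = 1 + -1 / (1 - m) := by field_simp; ring
    rw [e, rpow_add h.Qmoment_two_div_pos, rpow_one]
  · congr 1; field_simp; ring

theorem image_div_Ioo {z : ℝ} (hz : 0 < z) : (fun σ : ℝ => z / σ) '' Ioo 0 1 = Ioi z := by
  ext ρ
  constructor
  · rintro ⟨σ, hσ, rfl⟩
    exact (lt_div_iff₀ hσ.1).2 (by nlinarith [hσ.2])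
  · intro (hρ : z < ρ)
    have hρ0 : 0 < ρ := hz.trans hρ
    exact ⟨z / ρ, ⟨div_pos hz hρ0, (div_lt_one hρ0).2 hρ⟩, div_div_cancel₀ hz.ne'⟩

/-- The substitution `ρ = z/σ` turns the integral operator acting on `vss * f` into the average
of `f`. -/
theorem integral_K_mul (h : FastRange d α m) {U f : ℝ → ℝ} (hf : IsRatio f)
    (hU : ∀ z, 0 < z → U z = vss d α m z * f z) {z : ℝ} (hz : 0 < z) :
    IntegrableOn (fun ρ => K d α m z ρ * U ρ) (Ioi z) ∧
      ∫ ρ in Ioi z, K d α m z ρ * U ρ = vss d α m z ^ m * avg (ratioKernel d α m) f z := by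
  have hderiv : ∀ σ ∈ Ioo (0 : ℝ) 1,
      HasDerivWithinAt (fun σ : ℝ => z / σ) (-z / σ ^ 2) (Ioo 0 1) σ := by
    intro σ hσ
    have := (hasDerivAt_inv hσ.1.ne').const_mul z
    refine (this.congr_deriv ?_).hasDerivWithinAt
    rw [neg_div, div_eq_mul_inv, mul_neg]
  have hinj : InjOn (fun σ : ℝ => z / σ) (Ioo 0 1) := by
    intro σ hσ τ hτ hστ
    have h1 : z / σ = z / τ := hστ
    rw [div_eq_div_iff hσ.1.ne' hτ.1.ne'] at h1
    exact (mul_left_cancel₀ hz.ne' h1).symm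
  have heq : ∀ σ ∈ Ioo (0 : ℝ) 1, |(-z / σ ^ 2)| • (K d α m z (z / σ) * U (z / σ)) =
      vss d α m z ^ m * (ratioKernel d α m σ * f (z / σ)) := by
    intro σ hσ
    have hσ0 := hσ.1
    have hN := h.Qmoment_two_div_pos
    have h1 := h.one_sub_pos
    rw [hU _ (div_pos hz hσ0), h.vss_rpow hz, K, div_div_cancel₀ hz.ne', ratioKernel, neg_div,
      abs_neg, abs_of_pos (by positivity), smul_eq_mul, vss, neg_div, div_rpow_neg hz hσ0,
      rpow_sub hz, rpow_two, rpow_sub hσ0, rpow_neg hz.le, show (3 : ℝ) = (3 : ℕ) by norm_num,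
      rpow_natCast]
    have := rpow_pos_of_pos hz (2 / (1 - m))
    generalize z ^ (2 / (1 - m)) = Z at *
    generalize σ ^ (2 / (1 - m)) = S at *
    generalize Qmoment d α m (2 / (1 - m)) = N at *
    field_simp
  constructor
  · rw [← image_div_Ioo hz, integrableOn_image_iff_integrableOn_abs_deriv_smul measurableSet_Ioo
      hderiv hinj, integrableOn_congr_fun heq measurableSet_Ioo]
    exact (h.isDensity_ratioKernel.integrableOn_avg hf hz).const_mul _
  · rw [← image_div_Ioo hz, integral_image_eq_integral_abs_deriv_smul measurableSet_Ioo
      hderiv hinj, setIntegral_congr_fun measurableSet_Ioo heq, integral_const_mul, avg]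

theorem fixOp_eq (h : FastRange d α m) {U f : ℝ → ℝ} (hf : IsRatio f)
    (hU : ∀ z, 0 < z → U z = vss d α m z * f z) {z : ℝ} (hz : 0 < z) :
    fixOp d α m U z = vss d α m z * ratioStep (ratioKernel d α m) m f z := by
  have hv := (h.vss_pos hz).le
  rw [fixOp, (h.integral_K_mul hf hU hz).2,
    mul_rpow (rpow_nonneg hv _) (h.isDensity_ratioKernel.avg_nonneg hf hz), ← rpow_mul hv,
    mul_one_div_cancel h.m_pos.ne', rpow_one, ratioStep]

theorem iterate_fixOp_subsol (h : FastRange d α m) (n : ℕ) {z : ℝ} (hz : 0 < z) :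
    (fixOp d α m)^[n] (subsol d α m) z = vss d α m z *
      (ratioStep (ratioKernel d α m) m)^[n] (startRatio (gammaStar d α m)) z := by
  induction n generalizing z with
  | zero => rfl
  | succ n ih =>
    rw [Function.iterate_succ_apply', Function.iterate_succ_apply']
    exact h.fixOp_eq ((isRatio_startRatio h.isTailKernel.exponent_pos).iterate
      h.isDensity_ratioKernel h.m_pos n) (fun z hz => ih hz) hz

theorem tendsto_iterate_fixOp (h : FastRange d α m) {z : ℝ} (hz : 0 < z) :
    Tendsto (fun n : ℕ => (fixOp d α m)^[n] (subsol d α m) z) atTop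
      (𝓝 (vss d α m z * limitRatio (ratioKernel d α m) m (gammaStar d α m) z)) := by
  simp_rw [h.iterate_fixOp_subsol _ hz]
  exact (h.isTailKernel.tendsto_iterate hz).const_mul _

theorem canonicalProfile_eq (h : FastRange d α m) {z : ℝ} (hz : 0 < z) :
    canonicalProfile d α m z =
      vss d α m z * limitRatio (ratioKernel d α m) m (gammaStar d α m) z :=
  (h.tendsto_iterate_fixOp hz).limUnder_eq

theorem solvesProfileEq_of_ratio (h : FastRange d α m) {U f : ℝ → ℝ} (hf : IsRatio f)
    (hU : ∀ z, 0 < z → U z = vss d α m z * f z)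
    (hfix : ∀ z, 0 < z → f z ^ m = avg (ratioKernel d α m) f z) : SolvesProfileEq d α m U := by
  intro z hz
  refine ⟨(h.integral_K_mul hf hU hz).1, ?_⟩
  rw [(h.integral_K_mul hf hU hz).2, hU z hz, mul_rpow (h.vss_pos hz).le (hf.nonneg z hz),
    hfix z hz]

/-- Positive profiles are strictly decreasing, because `K` is nonincreasing in its first argument
and the domain of integration shrinks. -/
theorem strictAntiOn_of_solvesProfileEq (h : FastRange d α m) {U : ℝ → ℝ}
    (hU : SolvesProfileEq d α m U) (hpos : ∀ z, 0 < z → 0 < U z) : StrictAntiOn U (Ioi 0) := by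
  intro z (hz : 0 < z) w (hw : 0 < w) hzw
  have hK : ∀ x ρ, 0 < x → x < ρ → 0 < K d α m x ρ := fun x ρ hx hρ =>
    mul_pos (hx.trans hρ) (h.Q_pos ⟨div_pos hx (hx.trans hρ), (div_lt_one (hx.trans hρ)).2 hρ⟩)
  have hi := (hU z hz).1
  have hi1 := hi.mono_set (Ioc_subset_Ioi_self : Ioc z w ⊆ Ioi z)
  have hi2 := hi.mono_set (Ioi_subset_Ioi hzw.le)
  refine (rpow_lt_rpow_iff (hpos w hw).le (hpos z hz).le h.m_pos).1 ?_
  rw [(hU z hz).2, (hU w hw).2, ← Ioc_union_Ioi_eq_Ioi hzw.le,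
    setIntegral_union (Ioc_disjoint_Ioi le_rfl) measurableSet_Ioi hi1 hi2]
  have h1 : 0 < ∫ ρ in Ioc z w, K d α m z ρ * U ρ := by
    rw [setIntegral_pos_iff_support_of_nonneg_ae _ hi1]
    · refine lt_of_lt_of_le (?_ : 0 < volume (Ioc z w)) (measure_mono fun ρ hρ => ⟨?_, hρ⟩)
      · simp [hzw]
      · exact (mul_pos (hK z ρ hz hρ.1) (hpos ρ (hz.trans hρ.1))).ne'
    · filter_upwards [ae_restrict_mem measurableSet_Ioc] with ρ hρ
      exact (mul_pos (hK z ρ hz hρ.1) (hpos ρ (hz.trans hρ.1))).le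
  have h2 : ∫ ρ in Ioi w, K d α m w ρ * U ρ ≤ ∫ ρ in Ioi w, K d α m z ρ * U ρ := by
    refine setIntegral_mono_on (hU w hw).1 hi2 measurableSet_Ioi fun ρ (hρ : w < ρ) => ?_
    have hρ0 : 0 < ρ := hw.trans hρ
    refine mul_le_mul_of_nonneg_right ?_ (hpos ρ hρ0).le
    refine mul_le_mul_of_nonneg_left (h.Q_antitoneOn ?_ ?_ ?_) hρ0.le
    · exact ⟨div_pos hz hρ0, (div_lt_one hρ0).2 (hzw.trans hρ)⟩
    · exact ⟨div_pos hw hρ0, (div_lt_one hρ0).2 hρ⟩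
    · exact div_le_div_of_nonneg_right hzw.le hρ0.le
  linarith

/-! ### The mass of the canonical profile -/

theorem continuousOn_canonicalProfile (h : FastRange d α m) :
    ContinuousOn (canonicalProfile d α m) (Ioi 0) := by
  refine ContinuousOn.congr ?_ fun z hz => h.canonicalProfile_eq hz
  refine ContinuousOn.mul (continuousOn_const.mul fun z hz => ?_)
    h.isTailKernel.isRatio_limitRatio.cont
  exact (continuousAt_rpow_const _ _ (Or.inl (ne_of_gt hz))).continuousWithinAt

theorem canonicalProfile_pos (h : FastRange d α m) {z : ℝ} (hz : 0 < z) :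
    0 < canonicalProfile d α m z := by
  rw [h.canonicalProfile_eq hz]; exact mul_pos (h.vss_pos hz) (h.isTailKernel.limitRatio_pos hz)

/-- Near zero the decay of the quotient by the very singular solution, of an order
`a/m > 2/(1-m) - d`, makes the integral converge. -/
theorem integrableOn_canonicalProfile_mul (h : FastRange d α m) (hd : 1 ≤ d) :
    IntegrableOn (fun ρ => canonicalProfile d α m ρ * ρ ^ ((d : ℝ) - 1)) (Ioi 0) := by
  have hV := h.isTailKernel.isRatio_limitRatio
  have hm := h.m_pos
  have h1 := h.one_sub_pos
  have hc := h.cStar_pos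
  set p := 2 / (1 - m) with hp
  have hpm : p * (1 - m) = 2 := by rw [hp]; field_simp
  obtain ⟨a, ha1, ha2⟩ : ∃ a, m * (p - d) < a ∧ a < min (p - d) (p - 2) := by
    have hpd : 0 < p - d := sub_pos.2 h.dim_lt
    refine exists_between (lt_min (by nlinarith) ?_)
    have : 0 < m * d := mul_pos hm (by exact_mod_cast hd)
    nlinarith
  have ha0 : 0 < a := lt_trans (mul_pos hm (sub_pos.2 h.dim_lt)) ha1
  have hap : (d : ℝ) < p - a := by linarith [ha2.trans_le (min_le_left _ _)]
  have hap2 : 2 < p - a := by linarith [ha2.trans_le (min_le_right _ _)]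
  obtain ⟨C, hC0, hC⟩ := h.isTailKernel.exists_limitRatio_le_rpow ha0 (by
    rw [integrableOn_congr_fun (fun σ hσ => ratioKernel_mul_rpow hσ.1 (-a)) measurableSet_Ioo]
    exact (h.integrableOn_Q_mul hap hap2).1.div_const _)
  have hmeas : AEStronglyMeasurable (fun ρ => canonicalProfile d α m ρ * ρ ^ ((d : ℝ) - 1))
      (volume.restrict (Ioi 0)) := by
    refine ContinuousOn.aestronglyMeasurable ?_ measurableSet_Ioi
    refine h.continuousOn_canonicalProfile.mul fun z hz => ?_
    exact (continuousAt_rpow_const _ _ (Or.inl (ne_of_gt hz))).continuousWithinAt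
  have hval : ∀ ρ, 0 < ρ → canonicalProfile d α m ρ * ρ ^ ((d : ℝ) - 1) = cStar d α m *
      (limitRatio (ratioKernel d α m) m (gammaStar d α m) ρ * ρ ^ (-p + (d - 1))) := by
    intro ρ hρ
    rw [h.canonicalProfile_eq hρ, vss, rpow_add hρ, neg_div]
    ring
  rw [← Ioc_union_Ioi_eq_Ioi (zero_le_one' ℝ)]
  refine IntegrableOn.union ?_ ?_
  · have hb : IntegrableOn (fun ρ : ℝ => cStar d α m * (C * ρ ^ (a / m - p + (d - 1))))
        (Ioc 0 1) := by
      have hexp : -1 < a / m - p + (d - 1) := by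
        have : p - d < a / m := by rw [lt_div_iff₀ hm]; linarith
        linarith
      have := intervalIntegral.intervalIntegrable_rpow' (a := 0) (b := 1) hexp
      rw [intervalIntegrable_iff_integrableOn_Ioc_of_le zero_le_one] at this
      exact (this.const_mul C).const_mul _
    refine Integrable.mono' hb (hmeas.mono_set Ioc_subset_Ioi_self) ?_
    filter_upwards [ae_restrict_mem measurableSet_Ioc] with ρ hρ
    have hρ0 := hρ.1
    rw [hval ρ hρ0, Real.norm_of_nonneg (mul_nonneg hc.le (mul_nonneg (hV.nonneg _ hρ0)
      (rpow_nonneg hρ0.le _)))]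
    refine mul_le_mul_of_nonneg_left ?_ hc.le
    have e : C * ρ ^ (a / m - p + (d - 1)) = C * ρ ^ (a / m) * ρ ^ (-p + ((d : ℝ) - 1)) := by
      rw [mul_assoc, ← rpow_add hρ0]; congr 2; ring
    rw [e]
    exact mul_le_mul_of_nonneg_right (hC ρ hρ0) (rpow_nonneg hρ0.le _)
  · have hb : IntegrableOn (fun ρ : ℝ => cStar d α m * ρ ^ (-p + ((d : ℝ) - 1))) (Ioi 1) :=
      (integrableOn_Ioi_rpow_of_lt (by linarith [h.dim_lt]) one_pos).const_mul _
    refine Integrable.mono' hb (hmeas.mono_set (Ioi_subset_Ioi zero_le_one)) ?_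
    filter_upwards [ae_restrict_mem measurableSet_Ioi] with ρ hρ
    have hρ0 : 0 < ρ := one_pos.trans hρ
    rw [hval ρ hρ0, Real.norm_of_nonneg (mul_nonneg hc.le (mul_nonneg (hV.nonneg _ hρ0)
      (rpow_nonneg hρ0.le _)))]
    exact mul_le_mul_of_nonneg_left (mul_le_of_le_one_left (rpow_nonneg hρ0.le _)
      (hV.le_one _ hρ0)) hc.le

theorem sphereArea_pos (hd : 1 ≤ d) : 0 < sphereArea d := by
  have : Nonempty (Fin d) := ⟨⟨0, hd⟩⟩
  rw [sphereArea, measureReal_def, Measure.toSphere_apply_univ]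
  refine ENNReal.toReal_pos (mul_ne_zero ?_ ?_) (ENNReal.mul_ne_top ?_ ?_)
  · simpa using Nat.one_le_iff_ne_zero.1 hd
  · exact (Metric.measure_ball_pos _ _ one_pos).ne'
  · simp
  · exact measure_ball_lt_top.ne

theorem mass_canonicalProfile_pos (h : FastRange d α m) (hd : 1 ≤ d) :
    0 < mass d (canonicalProfile d α m) := by
  refine mul_pos (sphereArea_pos hd) ?_
  have hpos : ∀ ρ ∈ Ioi (0 : ℝ), 0 < canonicalProfile d α m ρ * ρ ^ ((d : ℝ) - 1) :=
    fun ρ hρ => mul_pos (h.canonicalProfile_pos hρ) (rpow_pos_of_pos hρ _)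
  rw [setIntegral_pos_iff_support_of_nonneg_ae _ (h.integrableOn_canonicalProfile_mul hd)]
  · refine lt_of_lt_of_le (?_ : 0 < volume (Ioi (0 : ℝ)))
      (measure_mono fun ρ hρ => ⟨(hpos ρ hρ).ne', hρ⟩)
    simp
  · filter_upwards [ae_restrict_mem measurableSet_Ioi] with ρ hρ using (hpos ρ hρ).le

/-! ### The rescaled profiles -/

theorem scaling_exponent_pos (h : FastRange d α m) : 0 < 1 + (m - 1) * (d : ℝ) / 2 := by
  nlinarith [h.dim]

theorem amp_pos (h : FastRange d α m) (hd : 1 ≤ d) {M : ℝ} (hM : 0 < M) : 0 < amp d α m M :=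
  rpow_pos_of_pos (div_pos hM (h.mass_canonicalProfile_pos hd)) _

theorem lenFactor_pos (h : FastRange d α m) (hd : 1 ≤ d) {M : ℝ} (hM : 0 < M) :
    0 < lenFactor d α m M :=
  rpow_pos_of_pos (h.amp_pos hd hM) _

theorem lenFactor_eq (h : FastRange d α m) (hd : 1 ≤ d) {M : ℝ} (hM : 0 < M) :
    lenFactor d α m M = (M / mass d (canonicalProfile d α m)) ^
      (1 / (1 + (m - 1) * (d : ℝ) / 2) * (-(m - 1) / 2)) := by
  rw [lenFactor, amp, ← rpow_mul (div_pos hM (h.mass_canonicalProfile_pos hd)).le]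

theorem lenFactor_exponent_pos (h : FastRange d α m) :
    0 < 1 / (1 + (m - 1) * (d : ℝ) / 2) * (-(m - 1) / 2) :=
  mul_pos (one_div_pos.2 h.scaling_exponent_pos) (by linarith [h.one_sub_pos])

theorem profile_eq (h : FastRange d α m) (hd : 1 ≤ d) {M : ℝ} (hM : 0 < M) {z : ℝ}
    (hz : 0 < z) : profile d α m M z = vss d α m z *
      limitRatio (ratioKernel d α m) m (gammaStar d α m) (lenFactor d α m M * z) := by
  have hA := h.amp_pos hd hM
  have hL := h.lenFactor_pos hd hM
  have h1 := h.one_sub_pos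
  have e : lenFactor d α m M ^ (-2 / (1 - m)) = (amp d α m M)⁻¹ := by
    rw [lenFactor, ← rpow_mul hA.le, ← rpow_neg_one]
    congr 1; field_simp; ring
  rw [profile, h.canonicalProfile_eq (mul_pos hL hz), vss, mul_rpow hL.le hz.le, e, vss]
  field_simp

theorem _root_.FastDiffusion.IsRatio.comp_mul_left {f : ℝ → ℝ} (hf : IsRatio f) {L : ℝ} (hL : 0 < L) :
    IsRatio fun z => f (L * z) where
  cont := hf.cont.comp (by fun_prop) fun z hz => mul_pos hL hz
  mono z hz w hw hzw := hf.mono (mul_pos hL hz) (mul_pos hL hw) (by gcongr)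
  nonneg z hz := hf.nonneg _ (mul_pos hL hz)
  le_one z hz := hf.le_one _ (mul_pos hL hz)

theorem solvesProfileEq_profile (h : FastRange d α m) (hd : 1 ≤ d) {M : ℝ} (hM : 0 < M) :
    SolvesProfileEq d α m (profile d α m M) := by
  have hL := h.lenFactor_pos hd hM
  refine h.solvesProfileEq_of_ratio (h.isTailKernel.isRatio_limitRatio.comp_mul_left hL)
    (fun z hz => h.profile_eq hd hM hz) fun z hz => ?_
  rw [h.isTailKernel.limitRatio_rpow (mul_pos hL hz), avg, avg]
  simp_rw [mul_div_assoc]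

theorem solvesProfileEq_canonicalProfile (h : FastRange d α m) :
    SolvesProfileEq d α m (canonicalProfile d α m) :=
  h.solvesProfileEq_of_ratio h.isTailKernel.isRatio_limitRatio
    (fun _ hz => h.canonicalProfile_eq hz) fun _ hz => h.isTailKernel.limitRatio_rpow hz

theorem profile_pos (h : FastRange d α m) (hd : 1 ≤ d) {M : ℝ} (hM : 0 < M) {z : ℝ}
    (hz : 0 < z) : 0 < profile d α m M z :=
  mul_pos (h.amp_pos hd hM) (h.canonicalProfile_pos (mul_pos (h.lenFactor_pos hd hM) hz))

theorem mass_profile (h : FastRange d α m) (hd : 1 ≤ d) {M : ℝ} (hM : 0 < M) :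
    IntegrableOn (fun ρ => profile d α m M ρ * ρ ^ ((d : ℝ) - 1)) (Ioi 0) ∧
      mass d (profile d α m M) = M := by
  have hA := h.amp_pos hd hM
  have hL := h.lenFactor_pos hd hM
  have hmass := h.mass_canonicalProfile_pos hd
  set g : ℝ → ℝ := fun ρ => canonicalProfile d α m ρ * ρ ^ ((d : ℝ) - 1) with hg
  have hgi : IntegrableOn g (Ioi 0) := h.integrableOn_canonicalProfile_mul hd
  set L := lenFactor d α m M with hLd
  set A := amp d α m M with hAd
  have heq : ∀ ρ ∈ Ioi (0 : ℝ), profile d α m M ρ * ρ ^ ((d : ℝ) - 1) =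
      A * L ^ (-((d : ℝ) - 1)) * g (L * ρ) := by
    intro ρ (hρ : 0 < ρ)
    have := rpow_pos_of_pos hL ((d : ℝ) - 1)
    change A * canonicalProfile d α m (L * ρ) * _ =
      A * _ * (canonicalProfile d α m (L * ρ) * (L * ρ) ^ _)
    rw [mul_rpow hL.le hρ.le, rpow_neg hL.le]
    field_simp
  constructor
  · rw [integrableOn_congr_fun heq measurableSet_Ioi]
    refine Integrable.const_mul ?_ _
    have := integrableOn_Ioi_comp_mul_left_iff g 0 hL
    rw [mul_zero] at this
    exact this.2 hgi
  · have hscale : A * L ^ (-(d : ℝ)) = M / mass d (canonicalProfile d α m) := by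
      have e : L ^ (-(d : ℝ)) = A ^ (-(-(m - 1) / 2 * d)) := by
        rw [hLd, lenFactor, ← rpow_mul hA.le]; congr 1; ring
      rw [e, ← rpow_one_add' hA.le (by nlinarith [h.dim]), hAd, amp, ← rpow_mul (by positivity)]
      have e2 : 1 / (1 + (m - 1) * (d : ℝ) / 2) * (1 + -(-(m - 1) / 2 * d)) = 1 := by
        rw [show 1 + -(-(m - 1) / 2 * d) = 1 + (m - 1) * (d : ℝ) / 2 by ring,
          one_div_mul_cancel h.scaling_exponent_pos.ne']
      rw [e2, rpow_one]
    have e3 : L ^ (-((d : ℝ) - 1)) * L⁻¹ = L ^ (-(d : ℝ)) := by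
      rw [← rpow_neg_one L, ← rpow_add hL]; congr 1; ring
    rw [mass, setIntegral_congr_fun measurableSet_Ioi heq, integral_const_mul,
      integral_comp_mul_left_Ioi g 0 hL, mul_zero, smul_eq_mul]
    calc _ = A * (L ^ (-((d : ℝ) - 1)) * L⁻¹) * mass d (canonicalProfile d α m) := by
          rw [mass]; ring
      _ = M := by rw [e3, hscale, div_mul_cancel₀ _ hmass.ne']

theorem lenFactor_lt (h : FastRange d α m) (hd : 1 ≤ d) {M₁ M₂ : ℝ} (hM₁ : 0 < M₁)
    (hM : M₁ < M₂) : lenFactor d α m M₁ < lenFactor d α m M₂ := by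
  have hmass := h.mass_canonicalProfile_pos hd
  rw [h.lenFactor_eq hd hM₁, h.lenFactor_eq hd (hM₁.trans hM)]
  exact rpow_lt_rpow (by positivity) (by gcongr) h.lenFactor_exponent_pos

theorem tendsto_lenFactor_atTop (h : FastRange d α m) (hd : 1 ≤ d) :
    Tendsto (lenFactor d α m) atTop atTop := by
  have h1 := (tendsto_rpow_atTop h.lenFactor_exponent_pos).comp
    (tendsto_id.atTop_div_const (h.mass_canonicalProfile_pos hd))
  refine h1.congr' ?_
  filter_upwards [eventually_gt_atTop 0] with M hM
  exact (h.lenFactor_eq hd hM).symm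

theorem tendsto_lenFactor_zero (h : FastRange d α m) (hd : 1 ≤ d) :
    Tendsto (lenFactor d α m) (𝓝[>] 0) (𝓝[>] 0) := by
  refine tendsto_nhdsWithin_iff.2 ⟨?_, ?_⟩
  · have h0 : Tendsto (fun M : ℝ => M / mass d (canonicalProfile d α m)) (𝓝[>] 0) (𝓝 0) := by
      have : Tendsto (fun M : ℝ => M / mass d (canonicalProfile d α m)) (𝓝 0) (𝓝 (0 / _)) :=
        tendsto_id.div_const _
      rw [zero_div] at this
      exact this.mono_left nhdsWithin_le_nhds
    have h1 := h0.rpow_const (Or.inr h.lenFactor_exponent_pos.le)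
    rw [zero_rpow h.lenFactor_exponent_pos.ne'] at h1
    refine h1.congr' ?_
    filter_upwards [self_mem_nhdsWithin] with M hM
    exact (h.lenFactor_eq hd hM).symm
  · filter_upwards [self_mem_nhdsWithin] with M hM using h.lenFactor_pos hd hM

theorem tendsto_profile_atTop (h : FastRange d α m) (hd : 1 ≤ d) {z : ℝ} (hz : 0 < z) :
    Tendsto (fun M => profile d α m M z) atTop (𝓝 (vss d α m z)) := by
  have h1 := (h.isTailKernel.tendsto_limitRatio_atTop.comp
    ((h.tendsto_lenFactor_atTop hd).atTop_mul_const hz)).const_mul (vss d α m z)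
  rw [mul_one] at h1
  refine h1.congr' ?_
  filter_upwards [eventually_gt_atTop 0] with M hM
  exact (h.profile_eq hd hM hz).symm

theorem tendsto_profile_zero (h : FastRange d α m) (hd : 1 ≤ d) {z : ℝ} (hz : 0 < z) :
    Tendsto (fun M => profile d α m M z) (𝓝[>] 0) (𝓝 0) := by
  have h0 : Tendsto (fun M => lenFactor d α m M * z) (𝓝[>] 0) (𝓝[>] 0) := by
    refine tendsto_nhdsWithin_iff.2 ⟨?_, ?_⟩
    · simpa using ((h.tendsto_lenFactor_zero hd).mono_right nhdsWithin_le_nhds).mul_const z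
    · filter_upwards [self_mem_nhdsWithin] with M hM using mul_pos (h.lenFactor_pos hd hM) hz
  have h1 := (h.isTailKernel.tendsto_limitRatio_zero.comp h0).const_mul (vss d α m z)
  rw [mul_zero] at h1
  refine h1.congr' ?_
  filter_upwards [self_mem_nhdsWithin] with M hM
  exact (h.profile_eq hd hM hz).symm

end FastRange

/-! ### The limit `α → 1` -/

theorem exp_sub_exp_le (a b : ℝ) : exp a - exp b ≤ |a - b| * exp a := by
  have h1 : exp b = exp a * exp (b - a) := by rw [← exp_add]; congr 1; ring
  have h2 := add_one_le_exp (b - a)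
  have h3 := le_abs_self (a - b)
  rw [h1]
  nlinarith [exp_pos a]

/-- On `[η, 1]` any difference of two powers is bounded by a multiple of `1 - s^β`. -/
theorem abs_rpow_sub_rpow_le_mul {η s x y β : ℝ} (hη : 0 < η) (hs : η ≤ s) (hs1 : s ≤ 1)
    (hβ : 0 < β) :
    |s ^ x - s ^ y| ≤ |x - y| * η ^ (-(|x| + |y|)) / (β * η ^ β) * (1 - s ^ β) := by
  have hs0 : 0 < s := hη.trans_le hs
  set u := -log s with hu
  have hu0 : 0 ≤ u := neg_nonneg.2 (log_nonpos hs0.le hs1)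
  have huη : u ≤ -log η := neg_le_neg (log_le_log hη hs)
  have hpow : ∀ t : ℝ, s ^ t = exp (-(t * u)) := by
    intro t; rw [rpow_def_of_pos hs0, hu]; congr 1; ring
  have hpowη : ∀ t : ℝ, η ^ t = exp (t * log η) := by
    intro t; rw [rpow_def_of_pos hη, mul_comm]
  have hnum : |s ^ x - s ^ y| ≤ |x - y| * η ^ (-(|x| + |y|)) * u := by
    have hle : ∀ t, |t| ≤ |x| + |y| → s ^ t ≤ η ^ (-(|x| + |y|)) := by
      intro t ht
      rw [hpow, hpowη]
      refine exp_le_exp.2 ?_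
      calc -(t * u) ≤ |t| * u := by nlinarith [neg_abs_le t]
        _ ≤ (|x| + |y|) * -log η := by gcongr
        _ = _ := by ring
    have key : ∀ t r, |t| ≤ |x| + |y| → |t - r| = |x - y| →
        s ^ t - s ^ r ≤ |x - y| * η ^ (-(|x| + |y|)) * u := by
      intro t r ht htr
      have h1 := exp_sub_exp_le (-(t * u)) (-(r * u))
      have h2 : |-(t * u) - -(r * u)| = |x - y| * u := by
        rw [← htr, ← abs_of_nonneg hu0, ← abs_mul, abs_of_nonneg hu0, ← abs_neg]; congr 1; ring
      rw [h2, ← hpow, ← hpow] at h1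
      calc _ ≤ |x - y| * u * s ^ t := h1
        _ ≤ |x - y| * u * η ^ (-(|x| + |y|)) := by
          gcongr; exact hle t ht
        _ = _ := by ring
    rw [abs_sub_le_iff]
    exact ⟨key x y (by linarith [abs_nonneg y]) rfl,
      key y x (by linarith [abs_nonneg x]) (abs_sub_comm _ _)⟩
  have hden : β * η ^ β * u ≤ 1 - s ^ β := by
    have h1 : η ^ β ≤ s ^ β := rpow_le_rpow hη.le hs hβ.le
    have h2 : s ^ β * (1 + β * u) ≤ 1 := by
      have := add_one_le_exp (β * u)
      calc s ^ β * (1 + β * u) ≤ s ^ β * exp (β * u) := by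
            gcongr
            linarith
        _ = 1 := by rw [hpow, ← exp_add]; simp
    have h3 : η ^ β * (β * u) ≤ s ^ β * (β * u) := by gcongr
    nlinarith
  have hηβ : 0 < β * η ^ β := mul_pos hβ (rpow_pos_of_pos hη _)
  refine hnum.trans ?_
  rw [div_mul_eq_mul_div, le_div_iff₀ hηβ]
  calc _ = |x - y| * η ^ (-(|x| + |y|)) * (β * η ^ β * u) := by ring
    _ ≤ _ := by gcongr

theorem continuousAt_Gamma_of_pos {s : ℝ} (hs : 0 < s) : ContinuousAt Gamma s :=
  (differentiableAt_Gamma fun n => by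
    have : (0 : ℝ) ≤ n := n.cast_nonneg
    linarith).continuousAt

namespace FastRange

variable {d : ℕ} {α m : ℝ}

/-- The integral of the weight against the derivative of `s^β`, `β = 1/b`. -/
theorem integral_weight_deriv (h : FastRange d α m) {η : ℝ} (hη : η ∈ Ioo (0 : ℝ) 1) :
    IntervalIntegrable (fun s => (1 - s ^ (1 / bExp d α m)) ^ (-α) *
      (1 / bExp d α m * s ^ (1 / bExp d α m - 1))) volume η 1 ∧
    ∫ s in η..1, (1 - s ^ (1 / bExp d α m)) ^ (-α) *
      (1 / bExp d α m * s ^ (1 / bExp d α m - 1)) =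
      (1 - η ^ (1 / bExp d α m)) ^ (1 - α) / (1 - α) := by
  have hβ : 0 < 1 / bExp d α m := one_div_pos.2 h.bExp_pos
  have hα : 0 < 1 - α := by linarith [h.α_lt_one]
  have hint : IntervalIntegrable (fun s => (1 - s ^ (1 / bExp d α m)) ^ (-α) *
      (1 / bExp d α m * s ^ (1 / bExp d α m - 1))) volume η 1 := by
    have h1 : IntervalIntegrable (fun s => weight d α m s *
        (1 / bExp d α m * s ^ (1 / bExp d α m - 1 - (1 - (d : ℝ))))) volume η 1 := by
      refine (h.intervalIntegrable_weight hη.1 hη.2.le).mul_continuousOn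
        (continuousOn_const.mul fun s hs => ?_)
      rw [uIcc_of_le hη.2.le] at hs
      exact (continuousAt_rpow_const _ _ (Or.inl (hη.1.trans_le hs.1).ne')).continuousWithinAt
    refine h1.congr fun s hs => ?_
    rw [uIoc_of_le hη.2.le] at hs
    have hs0 := hη.1.trans hs.1
    simp only [weight]
    rw [rpow_sub hs0 _ (1 - (d : ℝ))]
    have := rpow_pos_of_pos hs0 (1 - (d : ℝ))
    field_simp
  refine ⟨hint, ?_⟩
  set β := 1 / bExp d α m
  have hcont : ContinuousOn (fun s : ℝ => -((1 - s ^ β) ^ (1 - α) / (1 - α))) (Icc η 1) := by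
    refine ContinuousOn.neg (ContinuousOn.div_const ?_ _)
    refine ContinuousOn.rpow_const (continuousOn_const.sub fun s hs => ?_) fun _ _ => Or.inr hα.le
    exact (continuousAt_rpow_const _ _ (Or.inr hβ.le)).continuousWithinAt
  have hderiv : ∀ s ∈ Ioo η 1, HasDerivAt (fun s : ℝ => -((1 - s ^ β) ^ (1 - α) / (1 - α)))
      ((1 - s ^ β) ^ (-α) * (β * s ^ (β - 1))) s := by
    intro s hs
    have hs0 := hη.1.trans hs.1
    have h1 : s ^ β < 1 := rpow_lt_one hs0.le hs.2 hβ
    have d1 := (hasDerivAt_rpow_const (x := s) (p := β) (Or.inl hs0.ne')).const_sub 1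
    have d2 := ((d1.rpow_const (p := 1 - α) (Or.inl (by linarith))).div_const (1 - α)).neg
    refine d2.congr_deriv ?_
    rw [show 1 - α - 1 = -α by ring]
    field_simp
  rw [intervalIntegral.integral_eq_sub_of_hasDerivAt_of_le hη.2.le hcont hderiv hint]
  simp [zero_rpow hα.ne']

theorem Gamma_two_sub (h : FastRange d α m) : Gamma (2 - α) = (1 - α) * Gamma (1 - α) := by
  rw [← Gamma_add_one (by linarith [h.α_lt_one])]; congr 1; ring

/-- Up to the factor `β = 1/b`, the difference between `Q` and the explicit integral of
`integral_weight_deriv` is controlled by `1/Γ(1-α)`, as the singularity of the weight at `s = 1` is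
compensated. -/
theorem abs_Q_sub_le (h : FastRange d α m) {η : ℝ} (hη : η ∈ Ioo (0 : ℝ) 1) {β : ℝ}
    (hβ : β = 1 / bExp d α m) :
    |β * Q d α m η - (1 - η ^ β) ^ (1 - α) / Gamma (2 - α)| ≤
      (1 - α) / Gamma (2 - α) * (β * (|1 - (d : ℝ) - (β - 1)| *
        η ^ (-(|1 - (d : ℝ)| + |β - 1|)) / (β * η ^ β)) * |1 - η|) := by
  subst hβ
  have hβ : 0 < 1 / bExp d α m := one_div_pos.2 h.bExp_pos
  have hα : 0 < 1 - α := by linarith [h.α_lt_one]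
  have hG := h.Gamma_pos
  have hJ := h.integral_weight_deriv hη
  have hw := (h.intervalIntegrable_weight hη.1 hη.2.le).const_mul (1 / bExp d α m)
  set β := 1 / bExp d α m with hβd
  set C := |1 - (d : ℝ) - (β - 1)| * η ^ (-(|1 - (d : ℝ)| + |β - 1|)) / (β * η ^ β) with hC
  have e1 : β * Q d α m η - (1 - η ^ β) ^ (1 - α) / Gamma (2 - α) =
      1 / Gamma (1 - α) * ∫ s in η..1, (β * weight d α m s -
        (1 - s ^ β) ^ (-α) * (β * s ^ (β - 1))) := by
    rw [intervalIntegral.integral_sub hw hJ.1, hJ.2, intervalIntegral.integral_const_mul, Q_eq,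
      h.Gamma_two_sub]
    field_simp
  have e2 : (1 - α) / Gamma (2 - α) = 1 / Gamma (1 - α) := by
    rw [h.Gamma_two_sub]; field_simp
  rw [e1, e2, abs_mul, abs_of_pos (one_div_pos.2 hG)]
  refine mul_le_mul_of_nonneg_left ?_ (one_div_pos.2 hG).le
  rw [← Real.norm_eq_abs (∫ s in η..1, _)]
  refine intervalIntegral.norm_integral_le_of_norm_le_const fun s hs => ?_
  rw [uIoc_of_le hη.2.le] at hs
  have hs0 := hη.1.trans hs.1
  have hsβ : s ^ β ≤ 1 := rpow_le_one hs0.le hs.2 hβ.le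
  have h1 := abs_rpow_sub_rpow_le_mul (x := 1 - (d : ℝ)) (y := β - 1) hη.1 hs.1.le hs.2 hβ
  have hC0 : 0 ≤ C := by
    have := rpow_pos_of_pos hη.1 (-(|1 - (d : ℝ)| + |β - 1|))
    have := rpow_pos_of_pos hη.1 β
    positivity
  have hW : (1 - s ^ β) ^ (-α) * (1 - s ^ β) ≤ 1 := by
    rcases (sub_nonneg.2 hsβ).eq_or_lt with h0 | h0
    · rw [← h0, mul_zero]; exact zero_le_one
    · rw [← rpow_add_one h0.ne']
      exact rpow_le_one h0.le (by linarith [rpow_pos_of_pos hs0 β]) (by linarith)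
  have hW0 : 0 ≤ (1 - s ^ β) ^ (-α) := rpow_nonneg (sub_nonneg.2 hsβ) _
  have e3 : β * weight d α m s - (1 - s ^ β) ^ (-α) * (β * s ^ (β - 1)) =
      β * (1 - s ^ β) ^ (-α) * (s ^ (1 - (d : ℝ)) - s ^ (β - 1)) := by
    rw [weight, ← hβd]; ring
  rw [e3, Real.norm_eq_abs, abs_mul, abs_of_nonneg (mul_nonneg hβ.le hW0)]
  calc _ ≤ β * (1 - s ^ β) ^ (-α) * (C * (1 - s ^ β)) := by
        refine mul_le_mul_of_nonneg_left h1 (mul_nonneg hβ.le hW0)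
    _ = β * C * ((1 - s ^ β) ^ (-α) * (1 - s ^ β)) := by ring
    _ ≤ β * C * 1 := mul_le_mul_of_nonneg_left hW (mul_nonneg hβ.le hC0)
    _ = _ := mul_one _

end FastRange

section Limit

variable {d : ℕ} {m : ℝ}

theorem tendsto_bExp (d : ℕ) (m : ℝ) :
    Tendsto (fun α => bExp d α m) (𝓝[<] 1) (𝓝 (bExp d 1 m)) :=
  ((tendsto_id.mono_left nhdsWithin_le_nhds).div_const _)

theorem bExp_one_pos (hdim : (d : ℝ) * (1 - m) < 2) : 0 < bExp d 1 m :=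
  div_pos one_pos (by linarith)

theorem eventually_fastRange (hm : 0 < m) (hm1 : m < 1) (hdim : (d : ℝ) * (1 - m) < 2) :
    ∀ᶠ α in 𝓝[<] (1 : ℝ), FastRange d α m := by
  filter_upwards [Ioo_mem_nhdsLT zero_lt_one] with α hα
  exact ⟨hm, hm1, hdim, hα.1, hα.2⟩

theorem tendsto_Gamma_two_sub :
    Tendsto (fun α : ℝ => Gamma (2 - α)) (𝓝[<] 1) (𝓝 1) := by
  have h1 : Tendsto (fun α : ℝ => 2 - α) (𝓝[<] 1) (𝓝 1) := by
    have : Tendsto (fun α : ℝ => 2 - α) (𝓝[<] 1) (𝓝 (2 - 1)) :=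
      tendsto_const_nhds.sub (tendsto_id.mono_left nhdsWithin_le_nhds)
    rwa [show (2 : ℝ) - 1 = 1 by norm_num] at this
  have h2 := (continuousAt_Gamma_of_pos one_pos).tendsto.comp h1
  rwa [Gamma_one] at h2

theorem tendsto_Q (hm : 0 < m) (hm1 : m < 1) (hdim : (d : ℝ) * (1 - m) < 2) {η : ℝ}
    (hη : η ∈ Ioo (0 : ℝ) 1) :
    Tendsto (fun α => Q d α m η) (𝓝[<] 1) (𝓝 (bExp d 1 m)) := by
  have hb := bExp_one_pos hdim
  set β₁ := 1 / bExp d 1 m with hβ₁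
  have hβ₁0 : 0 < β₁ := one_div_pos.2 hb
  have hβ : Tendsto (fun α => 1 / bExp d α m) (𝓝[<] 1) (𝓝 β₁) :=
    tendsto_const_nhds.div (tendsto_bExp d m) hb.ne'
  have hα : Tendsto (fun α : ℝ => 1 - α) (𝓝[<] 1) (𝓝 0) := by
    have : Tendsto (fun α : ℝ => 1 - α) (𝓝[<] 1) (𝓝 (1 - 1)) :=
      tendsto_const_nhds.sub (tendsto_id.mono_left nhdsWithin_le_nhds)
    rwa [sub_self] at this
  have hpow : ContinuousAt (fun x : ℝ => η ^ x) β₁ := continuousAt_const_rpow hη.1.ne'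
  -- the explicit part tends to one
  have hJ : Tendsto (fun α => (1 - η ^ (1 / bExp d α m)) ^ (1 - α) / Gamma (2 - α)) (𝓝[<] 1)
      (𝓝 1) := by
    have h1 : Tendsto (fun α => 1 - η ^ (1 / bExp d α m)) (𝓝[<] 1) (𝓝 (1 - η ^ β₁)) :=
      tendsto_const_nhds.sub (hpow.tendsto.comp hβ)
    have h2 : 1 - η ^ β₁ ≠ 0 := (sub_pos.2 (rpow_lt_one hη.1.le hη.2 hβ₁0)).ne'
    have h3 := (h1.rpow hα (Or.inl h2)).div tendsto_Gamma_two_sub one_ne_zero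
    rwa [rpow_zero, div_one] at h3
  -- the error bound tends to zero
  have hE : Tendsto (fun α => (1 - α) / Gamma (2 - α) * (1 / bExp d α m *
      (|1 - (d : ℝ) - (1 / bExp d α m - 1)| * η ^ (-(|1 - (d : ℝ)| + |1 / bExp d α m - 1|)) /
        (1 / bExp d α m * η ^ (1 / bExp d α m))) * |1 - η|)) (𝓝[<] 1) (𝓝 0) := by
    have h1 : ContinuousAt (fun β : ℝ => β * (|1 - (d : ℝ) - (β - 1)| *
        η ^ (-(|1 - (d : ℝ)| + |β - 1|)) / (β * η ^ β)) * |1 - η|) β₁ := by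
      refine ContinuousAt.mul (continuousAt_id.mul (ContinuousAt.div ?_ ?_ ?_)) continuousAt_const
      · refine ContinuousAt.mul (by fun_prop) ?_
        exact ContinuousAt.rpow continuousAt_const (by fun_prop) (Or.inl hη.1.ne')
      · exact continuousAt_id.mul hpow
      · exact (mul_pos hβ₁0 (rpow_pos_of_pos hη.1 _)).ne'
    have h2 := (hα.div tendsto_Gamma_two_sub one_ne_zero).mul (h1.tendsto.comp hβ)
    rw [zero_div, zero_mul] at h2
    exact h2
  have hdiff : Tendsto (fun α => 1 / bExp d α m * Q d α m η -
      (1 - η ^ (1 / bExp d α m)) ^ (1 - α) / Gamma (2 - α)) (𝓝[<] 1) (𝓝 0) := by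
    refine squeeze_zero_norm' ?_ hE
    filter_upwards [eventually_fastRange hm hm1 hdim] with α h using h.abs_Q_sub_le hη rfl
  have hsum := (hdiff.add hJ).mul (tendsto_bExp d m)
  rw [zero_add, one_mul] at hsum
  refine hsum.congr' ?_
  filter_upwards [eventually_fastRange hm hm1 hdim] with α h
  have := h.bExp_pos
  field_simp
  ring

theorem tendsto_Gamma_quotient (hm1 : m < 1) :
    Tendsto (fun α => Gamma (α / (1 - m)) / Gamma (1 - α + α / (1 - m))) (𝓝[<] 1) (𝓝 1) := by
  have h1 : 0 < 1 / (1 - m) := one_div_pos.2 (by linarith)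
  have e1 : Tendsto (fun α : ℝ => α / (1 - m)) (𝓝[<] 1) (𝓝 (1 / (1 - m))) :=
    (tendsto_id.mono_left nhdsWithin_le_nhds).div_const _
  have e2 : Tendsto (fun α : ℝ => 1 - α + α / (1 - m)) (𝓝[<] 1) (𝓝 (1 / (1 - m))) := by
    have := (tendsto_const_nhds (x := (1 : ℝ)).sub
      (tendsto_id.mono_left (nhdsWithin_le_nhds (a := (1 : ℝ)) (s := Iio 1)))).add e1
    rw [sub_self, zero_add] at this
    exact this
  have hc := (continuousAt_Gamma_of_pos h1).tendsto
  have := (hc.comp e1).div (hc.comp e2) (Gamma_pos_of_pos h1).ne'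
  rwa [div_self (Gamma_pos_of_pos h1).ne'] at this

theorem tendsto_Qmoment (hm : 0 < m) (hm1 : m < 1) (hdim : (d : ℝ) * (1 - m) < 2) :
    Tendsto (fun α => Qmoment d α m (2 / (1 - m))) (𝓝[<] 1)
      (𝓝 ((1 - m) * bExp d 1 m / (2 * m))) := by
  have h1 := (((tendsto_bExp d m).const_mul (1 - m)).div_const (2 * m)).mul
    (tendsto_Gamma_quotient hm1)
  rw [mul_one] at h1
  refine h1.congr' ?_
  filter_upwards [eventually_fastRange hm hm1 hdim] with α h using h.Qmoment_two_div.symm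

theorem tendsto_cStar (hm : 0 < m) (hm1 : m < 1) (hdim : (d : ℝ) * (1 - m) < 2) :
    Tendsto (fun α => cStar d α m) (𝓝[<] 1) (𝓝 (cStar d 1 m)) := by
  have hb := bExp_one_pos hdim
  have h1 : 0 < 1 - m := by linarith
  have e : cStar d 1 m = ((1 - m) * bExp d 1 m / (2 * m)) ^ (-1 / (1 - m)) := by
    have : 0 < Gamma (1 / (1 - m)) := Gamma_pos_of_pos (by positivity)
    rw [cStar, sub_self, zero_add, div_self this.ne', mul_one]
  rw [e]
  refine ((tendsto_Qmoment hm hm1 hdim).rpow_const (Or.inl (by positivity))).congr' ?_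
  filter_upwards [eventually_fastRange hm hm1 hdim] with α h using h.cStar_eq.symm

theorem tendsto_ratioKernel (hm : 0 < m) (hm1 : m < 1) (hdim : (d : ℝ) * (1 - m) < 2) {σ : ℝ}
    (hσ : σ ∈ Ioo (0 : ℝ) 1) :
    Tendsto (fun α => ratioKernel d α m σ) (𝓝[<] 1) (𝓝 (classicalKernel m σ)) := by
  have hb := bExp_one_pos hdim
  have h1 : 0 < 1 - m := by linarith
  have h2 := ((tendsto_Q hm hm1 hdim hσ).mul_const (σ ^ (2 / (1 - m) - 3))).div
    (tendsto_Qmoment hm hm1 hdim) (by positivity)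
  have e : classicalKernel m σ =
      bExp d 1 m * σ ^ (2 / (1 - m) - 3) / ((1 - m) * bExp d 1 m / (2 * m)) := by
    rw [classicalKernel, show 2 * m / (1 - m) - 1 = 2 / (1 - m) - 3 by field_simp; ring]
    field_simp
  rw [e]
  exact h2

theorem vss_mul_barenblattRatio (c : ℝ) (hm1 : m < 1) {z : ℝ} (hz : 0 < z) :
    c * z ^ (-2 / (1 - m)) * barenblattRatio m z = c * (1 - m + z ^ 2) ^ (-1 / (1 - m)) := by
  have h1 : 0 < 1 - m := by linarith
  have hy := rpow_pos_of_pos hz (-2)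
  have e1 : z ^ (-2 / (1 - m)) = (z ^ 2) ^ (-1 / (1 - m)) := by
    rw [← rpow_two, ← rpow_mul hz.le]; congr 1; ring
  rw [mul_assoc, e1, barenblattRatio, ← mul_rpow (by positivity) (by positivity)]
  congr 2
  rw [rpow_neg hz.le, rpow_two]
  field_simp
  ring

theorem tendsto_canonicalProfile (hm : 0 < m) (hm1 : m < 1) (hdim : (d : ℝ) * (1 - m) < 2) {z : ℝ}
    (hz : 0 < z) :
    Tendsto (fun α => canonicalProfile d α m z) (𝓝[<] 1)
      (𝓝 (cStar d 1 m * (1 - m + z ^ 2) ^ (-1 / (1 - m)))) := by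
  rw [← vss_mul_barenblattRatio _ hm1 hz, ← limitRatio_classicalKernel hm hm1 hz]
  refine Tendsto.congr' ?_ (((tendsto_cStar hm hm1 hdim).mul_const _).mul
    (tendsto_limitRatio ((eventually_fastRange hm hm1 hdim).mono fun α h => h.isTailKernel)
      (isTailKernel_classicalKernel hm hm1) (fun σ hσ => tendsto_ratioKernel hm hm1 hdim hσ) hz))
  filter_upwards [eventually_fastRange hm hm1 hdim] with α h
  exact (h.canonicalProfile_eq hz).symm

theorem mul_one_sub_lt_two_of_mCrit_lt (hd : 1 ≤ d) (hm : mCrit d < m) :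
    (d : ℝ) * (1 - m) < 2 := by
  have hd0 : (0 : ℝ) < d := by exact_mod_cast hd
  have h1 : 1 - 2 / (d : ℝ) < m := (le_max_left _ _).trans_lt hm
  have h2 : (d : ℝ) * (1 - m) < d * (2 / d) := by gcongr; linarith
  rwa [mul_div_cancel₀ _ hd0.ne'] at h2

end Limit

end FastDiffusion

theorem theorem4 (d : ℕ) (hd : 1 ≤ d) (m : ℝ) (hm : mCrit d < m) (hm1 : m < 1) :
    (∀ α : ℝ, 0 < α → α < 1 →
      -- the exponent of the tail is well defined
      ((0 < gammaStar d α m ∧ TailExponentEq d α m (gammaStar d α m)) ∧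
        ∀ γ, 0 < γ → TailExponentEq d α m γ → γ = gammaStar d α m) ∧
      -- the canonical profile is well defined, continuous, of finite mass, and a profile
      (∀ z, 0 < z → Tendsto (fun n : ℕ => ((fixOp d α m)^[n] (subsol d α m)) z) atTop
        (𝓝 (canonicalProfile d α m z))) ∧
      ContinuousOn (canonicalProfile d α m) (Ioi 0) ∧
      IntegrableOn (fun ρ => canonicalProfile d α m ρ * ρ ^ ((d : ℝ) - 1)) (Ioi 0) ∧
      SolvesProfileEq d α m (canonicalProfile d α m) ∧
      -- the rescaled profiles are profiles of the prescribed mass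
      (∀ M, 0 < M → SolvesProfileEq d α m (profile d α m M) ∧
        IntegrableOn (fun ρ => profile d α m M ρ * ρ ^ ((d : ℝ) - 1)) (Ioi 0) ∧
        mass d (profile d α m M) = M) ∧
      -- positivity and monotonicity in the space variable
      ((∀ z, 0 < z → 0 < canonicalProfile d α m z) ∧
        StrictAntiOn (canonicalProfile d α m) (Ioi 0) ∧
        ∀ M, 0 < M → (∀ z, 0 < z → 0 < profile d α m M z) ∧
          StrictAntiOn (profile d α m M) (Ioi 0)) ∧
      -- tail expansions
      (∃ R : ℝ → ℝ, R =o[atTop] (fun z : ℝ => z ^ (-gammaStar d α m)) ∧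
        (∀ z, 0 < z → canonicalProfile d α m z =
          vss d α m z * (1 - z ^ (-gammaStar d α m) + R z)) ∧
        ∀ M, 0 < M → ∀ z, 0 < z → profile d α m M z =
          vss d α m z * (1 - (lenFactor d α m M * z) ^ (-gammaStar d α m)
            + R (lenFactor d α m M * z))) ∧
      -- ordering in the mass and the two limits
      (∀ M₁ M₂, 0 < M₁ → M₁ < M₂ → ∀ z, 0 < z → profile d α m M₁ z < profile d α m M₂ z) ∧
      (∀ z, 0 < z → Tendsto (fun M => profile d α m M z) atTop (𝓝 (vss d α m z))) ∧
      (∀ z, 0 < z → Tendsto (fun M => profile d α m M z) (𝓝[>] 0) (𝓝 0))) ∧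
    -- the classical limit
    (∀ z, 0 < z → Tendsto (fun α => canonicalProfile d α m z) (𝓝[<] 1)
      (𝓝 (cStar d 1 m * (1 - m + z ^ 2) ^ (-1 / (1 - m))))) := by
  have hm0 : 0 < m := (le_max_right _ _).trans_lt hm
  have hdim := mul_one_sub_lt_two_of_mCrit_lt hd hm
  refine ⟨fun α hα hα1 => ?_, fun z hz => tendsto_canonicalProfile hm0 hm1 hdim hz⟩
  have h : FastRange d α m := ⟨hm0, hm1, hdim, hα, hα1⟩
  have hk := h.isTailKernel
  refine ⟨h.gammaStar_spec, ?_, h.continuousOn_canonicalProfile,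
    h.integrableOn_canonicalProfile_mul hd, h.solvesProfileEq_canonicalProfile,
    fun M hM => ⟨h.solvesProfileEq_profile hd hM, h.mass_profile hd hM⟩,
    ⟨fun z hz => h.canonicalProfile_pos hz,
      h.strictAntiOn_of_solvesProfileEq h.solvesProfileEq_canonicalProfile
        fun z hz => h.canonicalProfile_pos hz,
      fun M hM => ⟨fun z hz => h.profile_pos hd hM hz,
        h.strictAntiOn_of_solvesProfileEq (h.solvesProfileEq_profile hd hM)
          fun z hz => h.profile_pos hd hM hz⟩⟩,
    ⟨_, hk.limitRatio_sub_isLittleO, ?_, ?_⟩, ?_,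
    fun z hz => h.tendsto_profile_atTop hd hz, fun z hz => h.tendsto_profile_zero hd hz⟩
  · intro z hz
    rw [h.canonicalProfile_eq hz]
    exact h.tendsto_iterate_fixOp hz
  · intro z hz
    rw [h.canonicalProfile_eq hz]
    ring
  · intro M hM z hz
    rw [h.profile_eq hd hM hz]
    ring
  · intro M₁ M₂ hM₁ hM z hz
    rw [h.profile_eq hd hM₁ hz, h.profile_eq hd (hM₁.trans hM) hz]
    have hL := h.lenFactor_pos hd hM₁
    have hlt := h.lenFactor_lt hd hM₁ hM
    exact mul_lt_mul_of_pos_left (hk.limitRatio_strictMonoOn (mul_pos hL hz)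
      (mul_pos (hL.trans hlt) hz) (mul_lt_mul_of_pos_right hlt hz)) (h.vss_pos hz)
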